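/- Let $G$ be a finitely generated Kleinian group, with region of discontinuity $\Omega(G)\subset\widehat{\mathbb C}$, and let $\Delta\neq\emptyset$ be a $G$-invariant union of connected components of $\Omega(G)$. Let $L^\infty(\Delta,G)$ be the space of $\mu\in L^\infty(\Delta)$ (extended by $0$ to $\widehat{\mathbb C}$) with $\mu(g(z))\overline{g'(z)}=\mu(z)g'(z)$ for a.e. $z\in\Delta$ and all $g\in G$, let $L^\infty(\Delta,G)_1$ be its open unit ball $\{\|\mu\|_\infty<1\}$, and $\overline{L^\infty(\Delta,G)_1}$ the closure of this ball in $L^\infty(\Delta,G)$. For $\mu\in\overline{L^\infty(\Delta,G)_1}$ let $\Omega(\mu)$ be the set of points of $\widehat{\mathbb C}$ that have an open neighbourhood $U$ with $\|\mu|_U\|_\infty<1$, and $\Lambda(\mu)=\widehat{\mathbb C}\setminus\Omega(\mu)$. For open $U\subset\widehat{\mathbb C}$, $L^{2,1}_{loc}(U)$ is the set of continuous maps $w:U\to\widehat{\mathbb C}$ with locally square integrable distributional first derivatives (in local coordinates). A quasiconformal homeomorphism of $\widehat{\mathbb C}$ with complex dilatation $\nu$, $\|\nu\|_\infty<1$,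 is an orientation-preserving homeomorphism in $L^{2,1}_{loc}(\widehat{\mathbb C})$ with $\bar\partial w=\nu\,\partial w$ a.e. A noded family of arcs associated with $\mu$ is a countable (possibly finite or empty) collection $\mathcal F$ of pairwise disjoint simple arcs (with their end points) in $\widehat{\mathbb C}$ such that: each arc without its end points lies in $\Delta$; the spherical diameters of the arcs tend to $0$ (if there are infinitely many of them); $\Lambda(\mu)=\overline{\bigcup\mathcal F}$; $\Omega(\mu)$ is dense in $\widehat{\mathbb C}$; and for each $\alpha\in\mathcal F$ the group $\{g\in G: g(\alpha)=\alpha\}$ is a cyclic loxodromic group or a $\mathbb Z_2$-extension of a cyclic loxodromic group. A noded quasiconformal deformation of $G$ with complex dilatation $\mu$ is a continuous map $w:\widehat{\mathbb C}\to\widehat{\mathbb C}$ with $w|_{\Omega(\mu)}\in L^{2,1}_{loc}(\Omega(\mu))$ for which there is a noded family of arcs $\mathcal F$ associated with $\mu$ such that: (1) $w$ is injective on $\widehat{\mathbb C}\setminus\bigcup\mathcal F$; (2) $w|_{\Omega(\mu)}$ is a noded quasiconformal map with dilatation $\mu$, that is, it is orientation-preserving, it maps some component of $\Omega(\mu)$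 homeomorphically onto its image, $\bar\partial w=\mu\,\partial w$ a.e. in $\Omega(\mu)$, and there are $\mu_n\in L^\infty(\Delta,G)_1$ converging to $\mu$ a.e. in $\Omega(\mu)$ and quasiconformal homeomorphisms $w_n$ of $\widehat{\mathbb C}$ with complex dilatations $\mu_n$ converging to $w$ locally uniformly in $\Omega(\mu)$; (3) $w$ is constant on each arc of $\mathcal F$, with different constants on different arcs. Let $\mu\in\overline{L^\infty(\Delta,G)_1}$, and let $w_1$ and $w_2$ be noded quasiconformal deformations of $G$ with the same complex dilatation $\mu$. Then there is an orientation-preserving homeomorphism $T:\widehat{\mathbb C}\to\widehat{\mathbb C}$ with $T\circ w_1=w_2$ that maps $w_1(\Omega(\mu))$ conformally onto $w_2(\Omega(\mu))$. -/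

import Mathlib

open MeasureTheory Set Filter Topology
open scoped ContDiff Pointwise

noncomputable section

namespace NodedQC

/-- The Riemann sphere, with the topology of the one-point compactification of the plane. -/
abbrev Sphere : Type := OnePoint ℂ

/-! ### Coordinates, the spherical metric, orientation, conformal maps -/

/-- The complex number underlying a finite point of the sphere (junk value `0` at infinity). -/
def toC (p : Sphere) : ℂ := p.elim 0 id

/-- The inversion `p ↦ 1 / p` of the sphere. -/
def inversion (p : Sphere) : Sphere :=
  p.elim ((0 : ℂ) : Sphere) (fun z => if z = 0 then OnePoint.infty else ((z⁻¹ : ℂ) : Sphere))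

/-- The two standard coordinates of the sphere: `p` itself and `1 / p`.  Both are involutions, so
the same map also serves as the inverse of the coordinate. -/
def coord : Bool → Sphere → Sphere
  | false => id
  | true => inversion

/-- `f` read in the coordinate `i` of the source and the coordinate `j` of the target. -/
def rep (f : Sphere → Sphere) (i j : Bool) (z : ℂ) : ℂ := toC (coord j (f (coord i (z : Sphere))))

/-- The part of the plane on which `rep f i j` represents the restriction of `f` to `U`. -/
def repDomain (f : Sphere → Sphere) (U : Set Sphere) (i j : Bool) : Set ℂ :=
  {z | coord i (z : Sphere) ∈ U ∧ coord j (f (coord i (z : Sphere))) ≠ OnePoint.infty}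

/-- The inverse of the stereographic projection: the sphere as the unit sphere of `ℝ³`. -/
def toUnitSphere (p : Sphere) : EuclideanSpace ℝ (Fin 3) :=
  p.elim !₂[0, 0, 1] (fun z =>
    !₂[2 * z.re / (‖z‖ ^ 2 + 1), 2 * z.im / (‖z‖ ^ 2 + 1), (‖z‖ ^ 2 - 1) / (‖z‖ ^ 2 + 1)])

/-- The diameter of a set in the (chordal) spherical metric. -/
def sphericalDiam (A : Set Sphere) : ℝ := Metric.diam (toUnitSphere '' A)

/-- The local degree of `F` at `z₀` is one: the image of each small positively oriented circle
around `z₀` winds exactly once, in the positive sense, around `F z₀`.  The winding is measured by a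
continuous logarithm `L` of `F - F z₀` along the circle. -/
def HasLocalDegreeOne (F : ℂ → ℂ) (z₀ : ℂ) : Prop :=
  ∃ R : ℝ, 0 < R ∧ ∀ r : ℝ, 0 < r → r < R → ∃ L : ℝ → ℂ, Continuous L ∧
    (∀ t : ℝ, Complex.exp (L t) = F (circleMap z₀ r t) - F z₀) ∧
    L (2 * Real.pi) = L 0 + 2 * Real.pi * Complex.I

/-- `f` preserves orientation on the open set `U`: it has local degree one at each point of `U` near
which it is injective (for a homeomorphism of the sphere: at each point). -/
def PreservesOrientationOn (f : Sphere → Sphere) (U : Set Sphere) : Prop :=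
  ∀ p ∈ U, (∃ V ∈ 𝓝 p, InjOn f V) → ∀ i j : Bool, ∀ z : ℂ, coord i (z : Sphere) = p →
    coord j (f p) ≠ OnePoint.infty → HasLocalDegreeOne (rep f i j) z

/-- `f` maps the open set `U` conformally (bijectively and holomorphically) onto `V`. -/
def IsConformalFromOnto (f : Sphere → Sphere) (U V : Set Sphere) : Prop :=
  IsOpen U ∧ BijOn f U V ∧
    ∀ i j : Bool, ∀ z ∈ repDomain f U i j, DifferentiableAt ℂ (rep f i j) z

/-! ### Kleinian groups -/

/-- A Möbius transformation of the sphere. -/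
def IsMoebius (g : Equiv.Perm Sphere) : Prop :=
  ∃ A : GL (Fin 2) ℂ, ∀ p : Sphere, g p = A • p

/-- A loxodromic (including hyperbolic) Möbius transformation: conjugate to `z ↦ k z`, `1 < |k|`. -/
def IsLoxodromic (g : Equiv.Perm Sphere) : Prop :=
  ∃ (B : GL (Fin 2) ℂ) (k : ℂ), 1 < ‖k‖ ∧
    g (B • (OnePoint.infty : Sphere)) = B • (OnePoint.infty : Sphere) ∧
    ∀ z : ℂ, g (B • (z : Sphere)) = B • ((k * z : ℂ) : Sphere)

/-- The region of discontinuity of a group acting on the sphere. -/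
def regionOfDiscontinuity (G : Subgroup (Equiv.Perm Sphere)) : Set Sphere :=
  {p | ∃ U : Set Sphere, IsOpen U ∧ p ∈ U ∧
    {g : Equiv.Perm Sphere | g ∈ G ∧ (g '' U ∩ U).Nonempty}.Finite}

/-- A Kleinian group: a group of Möbius transformations that acts discontinuously somewhere. -/
def IsKleinian (G : Subgroup (Equiv.Perm Sphere)) : Prop :=
  (∀ g ∈ G, IsMoebius g) ∧ (regionOfDiscontinuity G).Nonempty

/-- `Δ` is a nonempty, `G`-invariant union of connected components of the region of discontinuity
of `G`. -/
def IsInvariantUnionOfComponents (G : Subgroup (Equiv.Perm Sphere)) (Δ : Set Sphere) : Prop :=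
  Δ.Nonempty ∧ Δ ⊆ regionOfDiscontinuity G ∧
    (∀ p ∈ Δ, connectedComponentIn (regionOfDiscontinuity G) p ⊆ Δ) ∧
    ∀ g ∈ G, g '' Δ = Δ

/-! ### Beltrami coefficients

A coefficient on `Δ` is a function of the affine coordinate, extended by zero outside `Δ`; the point
at infinity has measure zero. -/

/-- `L^∞(Δ, G)`. -/
def MemLInfty (G : Subgroup (Equiv.Perm Sphere)) (Δ : Set Sphere) (μ : ℂ → ℂ) : Prop :=
  MemLp μ ⊤ volume ∧ (∀ z : ℂ, (z : Sphere) ∉ Δ → μ z = 0) ∧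
    ∀ g ∈ G, ∀ᵐ z : ℂ, (z : Sphere) ∈ Δ →
      μ (rep g false false z) * (starRingEnd ℂ) (deriv (rep g false false) z)
        = μ z * deriv (rep g false false) z

/-- `L^∞(Δ, G)₁`, the Beltrami coefficients for `G` supported in `Δ`. -/
def MemUnitBall (G : Subgroup (Equiv.Perm Sphere)) (Δ : Set Sphere) (μ : ℂ → ℂ) : Prop :=
  MemLInfty G Δ μ ∧ eLpNorm μ ⊤ volume < 1

/-- The closure of `L^∞(Δ, G)₁` inside `L^∞(Δ, G)`. -/
def MemClosedBall (G : Subgroup (Equiv.Perm Sphere)) (Δ : Set Sphere) (μ : ℂ → ℂ) : Prop :=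
  MemLInfty G Δ μ ∧
    ∀ ε : ENNReal, 0 < ε → ∃ ν : ℂ → ℂ, MemUnitBall G Δ ν ∧ eLpNorm (μ - ν) ⊤ volume < ε

/-- The region of discontinuity `Ω(μ)` of `μ`. -/
def Omega (μ : ℂ → ℂ) : Set Sphere :=
  {p | ∃ U : Set Sphere, IsOpen U ∧ p ∈ U ∧
    eLpNorm μ ⊤ (volume.restrict {z : ℂ | (z : Sphere) ∈ U}) < 1}

/-- The limit set `Λ(μ)` of `μ`. -/
def Lambda (μ : ℂ → ℂ) : Set Sphere := (Omega μ)ᶜ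

/-! ### Weak derivatives and the Beltrami equation -/

/-- `∂φ = (φ_x - i φ_y) / 2`. -/
def dz (φ : ℂ → ℂ) (z : ℂ) : ℂ := (fderiv ℝ φ z 1 - Complex.I * fderiv ℝ φ z Complex.I) / 2

/-- `∂̄φ = (φ_x + i φ_y) / 2`. -/
def dzbar (φ : ℂ → ℂ) (z : ℂ) : ℂ := (fderiv ℝ φ z 1 + Complex.I * fderiv ℝ φ z Complex.I) / 2

/-- On the open set `V`, the distributional derivatives `∂F` and `∂̄F` are the locally square
integrable functions `a` and `b`. -/
def HasL2WeakDerivOn (F : ℂ → ℂ) (V : Set ℂ) (a b : ℂ → ℂ) : Prop :=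
  (∀ K : Set ℂ, IsCompact K → K ⊆ V →
    MemLp a 2 (volume.restrict K) ∧ MemLp b 2 (volume.restrict K)) ∧
  ∀ φ : ℂ → ℂ, ContDiff ℝ ∞ φ → HasCompactSupport φ → tsupport φ ⊆ V →
    ∫ z, F z * dz φ z = - ∫ z, a z * φ z ∧
    ∫ z, F z * dzbar φ z = - ∫ z, b z * φ z

/-- `w ∈ L^{2,1}_loc(U)`: a (continuous) map from the open set `U` to the sphere which, in local
coordinates, has locally square integrable distributional derivatives. -/
def MemL21loc (w : Sphere → Sphere) (U : Set Sphere) : Prop :=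
  ContinuousOn w U ∧
    ∀ i j : Bool, ∃ a b : ℂ → ℂ, HasL2WeakDerivOn (rep w i j) (repDomain w U i j) a b

/-- `∂̄w = μ ∂w` almost everywhere in `U`. -/
def SolvesBeltramiOn (μ : ℂ → ℂ) (w : Sphere → Sphere) (U : Set Sphere) : Prop :=
  ∀ j : Bool, ∃ a b : ℂ → ℂ, HasL2WeakDerivOn (rep w false j) (repDomain w U false j) a b ∧
    ∀ᵐ z : ℂ, z ∈ repDomain w U false j → b z = μ z * a z

/-- `w` is a quasiconformal homeomorphism of the sphere with complex dilatation `μ`. -/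
def IsQuasiconformalHomeo (μ : ℂ → ℂ) (w : Sphere ≃ₜ Sphere) : Prop :=
  MemLp μ ⊤ volume ∧ eLpNorm μ ⊤ volume < 1 ∧ PreservesOrientationOn w univ ∧
    MemL21loc w univ ∧ SolvesBeltramiOn μ w univ

/-! ### Noded quasiconformal maps and deformations -/

/-- The restriction of `w` to `Ω(μ)` is a noded quasiconformal map with dilatation `μ`. -/
def IsNodedQuasiconformalMap (G : Subgroup (Equiv.Perm Sphere)) (Δ : Set Sphere) (μ : ℂ → ℂ)
    (w : Sphere → Sphere) : Prop :=
  MemL21loc w (Omega μ) ∧ PreservesOrientationOn w (Omega μ) ∧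
  (∃ p ∈ Omega μ, IsEmbedding ((connectedComponentIn (Omega μ) p).domRestrict w)) ∧
  SolvesBeltramiOn μ w (Omega μ) ∧
  ∃ ν : ℕ → ℂ → ℂ, (∀ n, MemUnitBall G Δ (ν n)) ∧
    (∀ᵐ z : ℂ, (z : Sphere) ∈ Omega μ → Tendsto (fun n => ν n z) atTop (𝓝 (μ z))) ∧
    ∃ v : ℕ → (Sphere ≃ₜ Sphere), (∀ n, IsQuasiconformalHomeo (ν n) (v n)) ∧
      TendstoLocallyUniformlyOn (fun n p => toUnitSphere (v n p)) (fun p => toUnitSphere (w p))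
        atTop (Omega μ)

/-- `α` is a simple arc, end points included, whose interior is contained in `Δ`. -/
def IsArcIn (Δ α : Set Sphere) : Prop :=
  ∃ γ : unitInterval → Sphere, Continuous γ ∧ Function.Injective γ ∧ range γ = α ∧
    γ '' Ioo 0 1 ⊆ Δ

/-- The group of the elements of `G` that keep `α` invariant. -/
def arcStabilizer (G : Subgroup (Equiv.Perm Sphere)) (α : Set Sphere) :
    Subgroup (Equiv.Perm Sphere) :=
  G ⊓ MulAction.stabilizer (Equiv.Perm Sphere) α

/-- `H` is a cyclic loxodromic group or a `ℤ/2`-extension of a cyclic loxodromic group. -/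
def IsLoxodromicCyclicOrExtension (H : Subgroup (Equiv.Perm Sphere)) : Prop :=
  ∃ g : Equiv.Perm Sphere, IsLoxodromic g ∧
    (H = Subgroup.zpowers g ∨ (Subgroup.zpowers g ≤ H ∧ (Subgroup.zpowers g).relIndex H = 2))

/-- A noded family of arcs associated with `μ` (a countable, possibly finite or empty family). -/
def IsNodedFamily (G : Subgroup (Equiv.Perm Sphere)) (Δ : Set Sphere) (μ : ℂ → ℂ)
    (F : Set (Set Sphere)) : Prop :=
  F.Countable ∧ F.PairwiseDisjoint id ∧
  (∀ α ∈ F, IsArcIn Δ α) ∧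
  Tendsto (fun α : F => sphericalDiam (α : Set Sphere)) cofinite (𝓝 0) ∧
  Lambda μ = closure (⋃₀ F) ∧
  Dense (Omega μ) ∧
  ∀ α ∈ F, IsLoxodromicCyclicOrExtension (arcStabilizer G α)

/-- `w` is a noded quasiconformal deformation of `G` with complex dilatation `μ`. -/
def IsNodedDeformation (G : Subgroup (Equiv.Perm Sphere)) (Δ : Set Sphere) (μ : ℂ → ℂ)
    (w : Sphere → Sphere) : Prop :=
  Continuous w ∧ ∃ F : Set (Set Sphere), IsNodedFamily G Δ μ F ∧
    InjOn w (⋃₀ F)ᶜ ∧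
    IsNodedQuasiconformalMap G Δ μ w ∧
    ∃ c : F → Sphere, Function.Injective c ∧ ∀ α : F, ∀ p ∈ (α : Set Sphere), w p = c α

end NodedQC

end

noncomputable section

namespace NodedQC
open ContinuousLinearMap
open scoped Convolution

lemma exists_eLpNorm_translate_sub_le {A : ℂ → ℂ} (hA : MemLp A 2 volume) {ε : ENNReal}
    (hε : 0 < ε) :
    ∃ r > 0, ∀ t : ℂ, ‖t‖ < r → eLpNorm (fun x => A (x - t) - A x) 2 volume ≤ ε := by
  let G : ℂ → C(ℂ, ℂ) := fun t => (ContinuousMap.mk (fun p : ℂ × ℂ => p.2 - p.1)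
    (continuous_snd.sub continuous_fst)).curry t
  have hG : Continuous G := ContinuousMap.continuous _
  have hmp : ∀ t, MeasurePreserving (G t) (volume : Measure ℂ) volume := fun t =>
    measurePreserving_sub_right volume t
  have hcont := (continuous_const (y := hA.toLp A)).compMeasurePreservingLp hG hmp
    (by norm_num : (2 : ENNReal) ≠ ⊤)
  have h0 := hcont.continuousAt (x := (0 : ℂ))
  rw [ContinuousAt, EMetric.tendsto_nhds] at h0
  obtain ⟨r, hr, hball⟩ := Metric.eventually_nhds_iff.1 (h0 ε hε)
  refine ⟨r, hr, fun t ht => ?_⟩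
  have := (hball (y := t) (by simpa using ht)).le
  rw [Lp.edist_def] at this
  refine le_trans (le_of_eq ?_) this
  refine eLpNorm_congr_ae ?_
  have h1 : ∀ t, (Lp.compMeasurePreserving (G t) (hmp t) (hA.toLp A) : ℂ → ℂ) =ᵐ[volume]
      fun x => A (x - t) := fun t =>
    (Lp.coeFn_compMeasurePreserving _ (hmp t)).trans
      ((hmp t).quasiMeasurePreserving.ae_eq_comp hA.coeFn_toLp)
  filter_upwards [h1 t, h1 0] with x hx hx0
  simp only [Pi.sub_apply]
  rw [hx, hx0]; simp

lemma eLpNorm_two_sq {α : Type*} [MeasurableSpace α] (f : α → ℂ) (m : Measure α) :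
    eLpNorm f 2 m ^ 2 = ∫⁻ x, ‖f x‖ₑ ^ 2 ∂m := by
  have := eLpNorm_nnreal_pow_eq_lintegral (f := f) (μ := m) (p := 2) (by norm_num)
  simpa using this

lemma exists_eLpNorm_convolution_sub_le {A : ℂ → ℂ} (hA : MemLp A 2 volume) {ε : ENNReal}
    (hε : 0 < ε) :
    ∃ r > 0, ∀ φ : ContDiffBump (0 : ℂ), φ.rOut < r →
      eLpNorm (fun x => (A ⋆[(lsmul ℝ ℝ).flip, volume] φ.normed volume) x - A x) 2 volume ≤ ε := by
  obtain ⟨r, hr, hrA⟩ := exists_eLpNorm_translate_sub_le hA hε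
  refine ⟨r, hr, fun φ hφ => ?_⟩
  set ρ := φ.normed volume
  have hρc : Continuous ρ := φ.continuous_normed
  have hρ0 : ∀ t, 0 ≤ ρ t := φ.nonneg_normed
  let P : Measure ℂ := volume.withDensity fun t => ENNReal.ofReal (ρ t)
  have hρi : Integrable ρ volume := φ.integrable_normed
  have hPu : P univ = 1 := by
    simp only [P, withDensity_apply _ MeasurableSet.univ, Measure.restrict_univ]
    rw [← ofReal_integral_eq_lintegral_ofReal hρi (ae_of_all _ hρ0), φ.integral_normed]
    simp
  have : IsProbabilityMeasure P := ⟨hPu⟩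
  have hAm := hA.aestronglyMeasurable
  have hac : P ≪ volume := withDensity_absolutelyContinuous _ _
  have hmeas2 : AEStronglyMeasurable (fun p : ℂ × ℂ => A (p.1 - p.2) - A p.1)
      ((volume : Measure ℂ).prod P) := by
    refine AEStronglyMeasurable.mono_ac (Measure.AbsolutelyContinuous.rfl.prod hac) ?_
    refine AEStronglyMeasurable.sub ?_ ?_
    · exact hAm.comp_quasiMeasurePreserving (quasiMeasurePreserving_sub volume volume)
    · exact hAm.comp_fst
  have key : ∀ x, ‖(A ⋆[(lsmul ℝ ℝ).flip, volume] ρ) x - A x‖ₑ ^ 2 ≤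
      ∫⁻ t, ‖A (x - t) - A x‖ₑ ^ 2 ∂P := by
    intro x
    have hloc : LocallyIntegrable A volume := hA.locallyIntegrable (by norm_num)
    have hex := φ.hasCompactSupport_normed.convolutionExists_right ((lsmul ℝ ℝ (E := ℂ)).flip) hloc hρc x
      (μ := volume)
    have hint : Integrable (fun t => ρ t • A (x - t)) volume := by
      have := hex.integrable_swap
      simpa [ρ] using this
    have e1 : (A ⋆[(lsmul ℝ ℝ).flip, volume] ρ) x - A x = ∫ t, ρ t • (A (x - t) - A x) := by
      rw [convolution_eq_swap]
      simp only [smul_sub]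
      rw [integral_sub hint (hρi.smul_const _), integral_smul_const]
      simp [ρ, φ.integral_normed]
    have hAx : AEStronglyMeasurable (fun t => A (x - t) - A x) P := by
      refine AEStronglyMeasurable.mono_ac hac ?_
      refine AEStronglyMeasurable.sub ?_ aestronglyMeasurable_const
      exact hAm.comp_quasiMeasurePreserving (quasiMeasurePreserving_sub_left volume x)
    have e2 : ‖(A ⋆[(lsmul ℝ ℝ).flip, volume] ρ) x - A x‖ₑ ≤ eLpNorm (fun t => A (x - t) - A x) 1 P := by
      rw [e1, eLpNorm_one_eq_lintegral_enorm]
      refine (enorm_integral_le_lintegral_enorm _).trans (le_of_eq ?_)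
      simp only [P]
      rw [lintegral_withDensity_eq_lintegral_mul₀ (by fun_prop)]
      · refine lintegral_congr fun t => ?_
        simp only [Pi.mul_apply]
        rw [enorm_smul, Real.enorm_eq_ofReal (hρ0 t)]
      · exact ((hAm.comp_quasiMeasurePreserving
          (quasiMeasurePreserving_sub_left volume x)).sub aestronglyMeasurable_const).enorm
    calc _ ≤ (eLpNorm (fun t => A (x - t) - A x) 1 P) ^ 2 := by gcongr
      _ ≤ (eLpNorm (fun t => A (x - t) - A x) 2 P) ^ 2 := by
        gcongr
        exact eLpNorm_le_eLpNorm_of_exponent_le (by norm_num) hAx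
      _ = _ := eLpNorm_two_sq _ _
  have : eLpNorm (fun x => (A ⋆[(lsmul ℝ ℝ).flip, volume] ρ) x - A x) 2 volume ^ 2 ≤ ε ^ 2 := by
    rw [eLpNorm_two_sq]
    calc _ ≤ ∫⁻ x, ∫⁻ t, ‖A (x - t) - A x‖ₑ ^ 2 ∂P := lintegral_mono key
      _ = ∫⁻ t, (∫⁻ x, ‖A (x - t) - A x‖ₑ ^ 2 ∂volume) ∂P := by
        refine lintegral_lintegral_swap ?_
        exact hmeas2.enorm.pow_const _
      _ ≤ ∫⁻ t, ε ^ 2 ∂P := by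
        refine lintegral_mono_ae ?_
        simp only [P]
        rw [ae_withDensity_iff (by fun_prop)]
        refine ae_of_all _ fun t ht => ?_
        rw [← eLpNorm_two_sq]
        gcongr
        refine hrA t ?_
        have : t ∈ Function.support ρ := by
          intro h0; simp [h0] at ht
        rw [φ.support_normed_eq] at this
        have := mem_ball_zero_iff.1 this
        linarith
      _ = ε ^ 2 := by simp [hPu]
  exact (ENNReal.pow_right_strictMono (by norm_num)).le_iff_le.1 this

end NodedQC

namespace NodedQC
open ContinuousLinearMap
open scoped Convolution

lemma fderiv_ofReal_comp_sub {ρ : ℂ → ℝ} (hρ : ContDiff ℝ ∞ ρ) (z t v : ℂ) :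
    fderiv ℝ (fun t => ((ρ (z - t) : ℝ) : ℂ)) t v = -((fderiv ℝ ρ (z - t) v : ℝ) : ℂ) := by
  have h1 : HasFDerivAt ρ (fderiv ℝ ρ (z - t)) (z - t) :=
    (hρ.differentiable (by simp)).differentiableAt.hasFDerivAt
  have h2 : HasFDerivAt (fun t : ℂ => z - t) (-(ContinuousLinearMap.id ℝ ℂ)) t := by
    simpa using (hasFDerivAt_id (𝕜 := ℝ) t).const_sub z
  have h3 := (Complex.ofRealCLM.hasFDerivAt (x := ρ (z - t))).comp t (h1.comp t h2)
  have h4 : fderiv ℝ (fun t => ((ρ (z - t) : ℝ) : ℂ)) t = _ := HasFDerivAt.fderiv h3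
  rw [h4]; simp

lemma fderiv_convolution_apply {F : ℂ → ℂ} (hF : LocallyIntegrable F volume) {ρ : ℂ → ℝ}
    (hρ : ContDiff ℝ ∞ ρ) (hρc : HasCompactSupport ρ) (z v : ℂ) :
    fderiv ℝ (F ⋆[(lsmul ℝ ℝ).flip, volume] ρ) z v =
      -∫ t, F t * fderiv ℝ (fun t => ((ρ (z - t) : ℝ) : ℂ)) t v := by
  have h1 : ContDiff ℝ 1 ρ := hρ.of_le (by simp)
  rw [(hρc.hasFDerivAt_convolution_right (lsmul ℝ ℝ).flip hF h1 z).fderiv,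
    convolution_precompR_apply _ hF (hρc.fderiv ℝ) (h1.continuous_fderiv one_ne_zero),
    convolution_def, ← integral_neg]
  refine integral_congr_ae (ae_of_all _ fun t => ?_)
  simp only [fderiv_ofReal_comp_sub hρ]
  simp [mul_comm]

lemma integrable_mul_fderiv {F : ℂ → ℂ} (hF : LocallyIntegrable F volume) {φ : ℂ → ℂ}
    (hφ : ContDiff ℝ ∞ φ) (hφc : HasCompactSupport φ) (v : ℂ) :
    Integrable (fun t => F t * fderiv ℝ φ t v) volume := by
  have hc : Continuous fun t => fderiv ℝ φ t v :=
    (hφ.continuous_fderiv (by simp)).clm_apply continuous_const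
  have hs : HasCompactSupport fun t => fderiv ℝ φ t v :=
    (hφc.fderiv ℝ).comp_left (g := fun L : ℂ →L[ℝ] ℂ => L v) rfl
  have := hF.integrable_smul_left_of_hasCompactSupport hc hs
  simpa [mul_comm] using this

lemma dz_convolution {F : ℂ → ℂ} (hF : LocallyIntegrable F volume) {ρ : ℂ → ℝ}
    (hρ : ContDiff ℝ ∞ ρ) (hρc : HasCompactSupport ρ) (z : ℂ) :
    dz (F ⋆[(lsmul ℝ ℝ).flip, volume] ρ) z =
      -∫ t, F t * dz (fun t => ((ρ (z - t) : ℝ) : ℂ)) t ∧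
    dzbar (F ⋆[(lsmul ℝ ℝ).flip, volume] ρ) z =
      -∫ t, F t * dzbar (fun t => ((ρ (z - t) : ℝ) : ℂ)) t := by
  have hs : ContDiff ℝ ∞ (fun t => ((ρ (z - t) : ℝ) : ℂ)) :=
    Complex.ofRealCLM.contDiff.comp (hρ.comp (contDiff_const.sub contDiff_id))
  have hsc : HasCompactSupport (fun t => ((ρ (z - t) : ℝ) : ℂ)) := by
    have : HasCompactSupport (fun t => ρ (z - t)) :=
      hρc.comp_homeomorph (Homeomorph.subLeft z)
    exact this.comp_left (g := fun x : ℝ => (x : ℂ)) rfl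
  have i := fun v => integrable_mul_fderiv hF hs hsc v
  constructor
  · simp only [dz, fderiv_convolution_apply hF hρ hρc]
    have e : ∀ t, F t * ((fderiv ℝ (fun t => ((ρ (z - t) : ℝ) : ℂ)) t 1 -
        Complex.I * fderiv ℝ (fun t => ((ρ (z - t) : ℝ) : ℂ)) t Complex.I) / 2) =
        (F t * fderiv ℝ (fun t => ((ρ (z - t) : ℝ) : ℂ)) t 1 - Complex.I *
          (F t * fderiv ℝ (fun t => ((ρ (z - t) : ℝ) : ℂ)) t Complex.I)) / 2 := fun t => by ring
    simp only [e]
    rw [integral_div, integral_sub (i 1) ((i Complex.I).const_mul _), integral_const_mul]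
    ring
  · simp only [dzbar, fderiv_convolution_apply hF hρ hρc]
    have e : ∀ t, F t * ((fderiv ℝ (fun t => ((ρ (z - t) : ℝ) : ℂ)) t 1 +
        Complex.I * fderiv ℝ (fun t => ((ρ (z - t) : ℝ) : ℂ)) t Complex.I) / 2) =
        (F t * fderiv ℝ (fun t => ((ρ (z - t) : ℝ) : ℂ)) t 1 + Complex.I *
          (F t * fderiv ℝ (fun t => ((ρ (z - t) : ℝ) : ℂ)) t Complex.I)) / 2 := fun t => by ring
    simp only [e]
    rw [integral_div, integral_add (i 1) ((i Complex.I).const_mul _), integral_const_mul]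
    ring

/-- The Wirtinger derivatives of a mollification of `F` are the mollifications of the weak
derivatives of `F`. -/
lemma dz_convolution_indicator {F a b : ℂ → ℂ} {V : Set ℂ} (hF : ContinuousOn F V)
    (h : HasL2WeakDerivOn F V a b) {z₀ : ℂ} {R : ℝ}
    (hcl : Metric.closedBall z₀ (2 * R) ⊆ V) (φ : ContDiffBump (0 : ℂ)) (hφ : φ.rOut < R)
    {z : ℂ} (hz : z ∈ Metric.closedBall z₀ R) :
    dz ((Metric.closedBall z₀ (2 * R)).indicator F ⋆[(lsmul ℝ ℝ).flip, volume] φ.normed volume) z =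
      ((Metric.closedBall z₀ (2 * R)).indicator a ⋆[(lsmul ℝ ℝ).flip, volume] φ.normed volume) z ∧
    dzbar ((Metric.closedBall z₀ (2 * R)).indicator F ⋆[(lsmul ℝ ℝ).flip, volume] φ.normed volume) z =
      ((Metric.closedBall z₀ (2 * R)).indicator b ⋆[(lsmul ℝ ℝ).flip, volume] φ.normed volume) z := by
  set K := Metric.closedBall z₀ (2 * R)
  set ρ := φ.normed volume with hρdef
  have hKc : IsCompact K := isCompact_closedBall _ _
  have hFl : LocallyIntegrable (K.indicator F) volume :=
    (((hF.mono hcl).integrableOn_compact (μ := volume) hKc).integrable_indicator hKc.measurableSet).locallyIntegrable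
  have hρ : ContDiff ℝ ∞ ρ := φ.contDiff_normed
  have hρc : HasCompactSupport ρ := φ.hasCompactSupport_normed
  obtain ⟨e1, e2⟩ := dz_convolution hFl hρ hρc z
  have hs : ContDiff ℝ ∞ (fun t => ((ρ (z - t) : ℝ) : ℂ)) :=
    Complex.ofRealCLM.contDiff.comp (hρ.comp (contDiff_const.sub contDiff_id))
  have hsc : HasCompactSupport (fun t => ((ρ (z - t) : ℝ) : ℂ)) := by
    have : HasCompactSupport (fun t => ρ (z - t)) :=
      hρc.comp_homeomorph (Homeomorph.subLeft z)
    exact this.comp_left (g := fun x : ℝ => (x : ℂ)) rfl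
  have hsupp : Function.support (fun t => ((ρ (z - t) : ℝ) : ℂ)) ⊆ Metric.closedBall z φ.rOut := by
    intro t ht
    have : z - t ∈ Function.support ρ := by
      intro h0; simp [h0] at ht
    rw [hρdef, φ.support_normed_eq, mem_ball_zero_iff] at this
    rw [Metric.mem_closedBall, dist_comm, dist_eq_norm]; exact this.le
  have hts : tsupport (fun t => ((ρ (z - t) : ℝ) : ℂ)) ⊆ K := by
    refine (closure_minimal hsupp Metric.isClosed_closedBall).trans ?_
    refine Metric.closedBall_subset_closedBall' ?_
    rw [Metric.mem_closedBall] at hz; linarith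
  have hd : ∀ t, t ∉ K → fderiv ℝ (fun t => ((ρ (z - t) : ℝ) : ℂ)) t = 0 := fun t ht =>
    image_eq_zero_of_notMem_tsupport fun h' => ht (hts (tsupport_fderiv_subset ℝ h'))
  have h0 : ∀ t, t ∉ K → ((ρ (z - t) : ℝ) : ℂ) = 0 := fun t ht =>
    image_eq_zero_of_notMem_tsupport (f := fun t => ((ρ (z - t) : ℝ) : ℂ)) fun h' => ht (hts h')
  obtain ⟨w1, w2⟩ := h.2 _ hs hsc (hts.trans hcl)
  constructor
  · rw [e1, convolution_def, neg_eq_iff_eq_neg]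
    refine Eq.trans (integral_congr_ae (ae_of_all _ fun t => ?_)) (w1.trans
      (congrArg Neg.neg (integral_congr_ae (ae_of_all _ fun t => ?_))))
    · by_cases ht : t ∈ K
      · simp [ht]
      · simp [ht, dz, hd t ht]
    · by_cases ht : t ∈ K
      · simp [ht, mul_comm]
      · simp [ht, h0 t ht]
  · rw [e2, convolution_def, neg_eq_iff_eq_neg]
    refine Eq.trans (integral_congr_ae (ae_of_all _ fun t => ?_)) (w2.trans
      (congrArg Neg.neg (integral_congr_ae (ae_of_all _ fun t => ?_))))
    · by_cases ht : t ∈ K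
      · simp [ht]
      · simp [ht, dzbar, hd t ht]
    · by_cases ht : t ∈ K
      · simp [ht, mul_comm]
      · simp [ht, h0 t ht]

/-- The bump functions supported in the ball of radius `R / (n + 2)`. -/
def bumpSeq (R : ℝ) (hR : 0 < R) (n : ℕ) : ContDiffBump (0 : ℂ) where
  rIn := R / (n + 2) / 2
  rOut := R / (n + 2)
  rIn_pos := by positivity
  rIn_lt_rOut := by
    have : 0 < R / ((n : ℝ) + 2) := by positivity
    linarith

lemma bumpSeq_rOut_lt {R : ℝ} (hR : 0 < R) (n : ℕ) : (bumpSeq R hR n).rOut < R := by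
  simp only [bumpSeq]
  exact div_lt_self hR (by linarith [(Nat.cast_nonneg n : (0 : ℝ) ≤ n)])

lemma tendsto_bumpSeq_rOut {R : ℝ} (hR : 0 < R) :
    Tendsto (fun n => (bumpSeq R hR n).rOut) atTop (𝓝 0) := by
  simp only [bumpSeq]
  exact tendsto_const_nhds.div_atTop
    (tendsto_atTop_add_const_right _ _ tendsto_natCast_atTop_atTop)

lemma convolution_flip_eq (F : ℂ → ℂ) (ρ : ℂ → ℝ) :
    F ⋆[(lsmul ℝ ℝ).flip, volume] ρ = ρ ⋆[lsmul ℝ ℝ, volume] F := convolution_flip _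

lemma tendsto_convolution_indicator {a : ℂ → ℂ} {z₀ : ℂ} {R : ℝ} (hR : 0 < R)
    (ha : MemLp a 2 (volume.restrict (Metric.closedBall z₀ (2 * R)))) :
    Tendsto (fun n => eLpNorm (fun z => ((Metric.closedBall z₀ (2 * R)).indicator a
      ⋆[(lsmul ℝ ℝ).flip, volume] (bumpSeq R hR n).normed volume) z - a z) 2
      (volume.restrict (Metric.closedBall z₀ R))) atTop (𝓝 0) := by
  have hA : MemLp ((Metric.closedBall z₀ (2 * R)).indicator a) 2 volume :=
    (memLp_indicator_iff_restrict Metric.isClosed_closedBall.measurableSet).2 ha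
  rw [ENNReal.tendsto_nhds_zero]
  intro ε hε
  obtain ⟨r, hr, H⟩ := exists_eLpNorm_convolution_sub_le hA hε
  filter_upwards [(tendsto_bumpSeq_rOut hR).eventually (gt_mem_nhds hr)] with n hn
  refine le_trans ?_ (H _ hn)
  refine le_trans (le_of_eq ?_) (eLpNorm_mono_measure _
    (Measure.restrict_le_self (s := Metric.closedBall z₀ R)))
  refine eLpNorm_congr_ae ?_
  filter_upwards [ae_restrict_mem Metric.isClosed_closedBall.measurableSet] with z hz
  rw [indicator_of_mem (Metric.closedBall_subset_closedBall (by linarith) hz)]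

lemma tendstoUniformlyOn_convolution_indicator {F : ℂ → ℂ}
    {z₀ : ℂ} {R : ℝ} (hR : 0 < R) (hF : ContinuousOn F (Metric.closedBall z₀ (2 * R))) :
    TendstoUniformlyOn (fun n => (Metric.closedBall z₀ (2 * R)).indicator F
      ⋆[(lsmul ℝ ℝ).flip, volume] (bumpSeq R hR n).normed volume) F atTop
      (Metric.closedBall z₀ R) := by
  set K := Metric.closedBall z₀ (2 * R)
  have hKc : IsCompact K := isCompact_closedBall _ _
  have hu := hKc.uniformContinuousOn_of_continuous hF
  rw [Metric.uniformContinuousOn_iff_le] at hu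
  rw [Metric.tendstoUniformlyOn_iff]
  intro ε hε
  obtain ⟨δ, hδ, H⟩ := hu (ε / 2) (by linarith)
  filter_upwards [(tendsto_bumpSeq_rOut hR).eventually (gt_mem_nhds hδ)] with n hn z hz
  rw [dist_comm, convolution_flip_eq]
  refine lt_of_le_of_lt (b := ε / 2) ?_ (by linarith)
  have hzK : z ∈ K := Metric.closedBall_subset_closedBall (by linarith) hz
  rw [← indicator_of_mem hzK F]
  refine ContDiffBump.dist_normed_convolution_le ?_ fun x hx => ?_
  · exact (((hF).integrableOn_compact (μ := volume) hKc).integrable_indicator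
      hKc.measurableSet).aestronglyMeasurable
  · rw [Metric.mem_ball] at hx
    have hxK : x ∈ K := by
      rw [Metric.mem_closedBall] at hz ⊢
      have := bumpSeq_rOut_lt hR n
      linarith [dist_triangle x z z₀]
    rw [indicator_of_mem hzK, indicator_of_mem hxK]
    exact H x hxK z hzK (by linarith)

lemma exists_smooth_approx {F a b : ℂ → ℂ} {V : Set ℂ} (hF : ContinuousOn F V)
    (h : HasL2WeakDerivOn F V a b) {z₀ : ℂ} {R : ℝ} (hR : 0 < R)
    (hcl : Metric.closedBall z₀ (2 * R) ⊆ V) :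
    ∃ Fn : ℕ → ℂ → ℂ, (∀ n, ContDiff ℝ ∞ (Fn n)) ∧
      TendstoUniformlyOn Fn F atTop (Metric.closedBall z₀ R) ∧
      Tendsto (fun n => eLpNorm (fun z => dz (Fn n) z - a z) 2
        (volume.restrict (Metric.closedBall z₀ R))) atTop (𝓝 0) ∧
      Tendsto (fun n => eLpNorm (fun z => dzbar (Fn n) z - b z) 2
        (volume.restrict (Metric.closedBall z₀ R))) atTop (𝓝 0) := by
  have hKc : IsCompact (Metric.closedBall z₀ (2 * R)) := isCompact_closedBall _ _
  have hFi := (((hF.mono hcl).integrableOn_compact (μ := volume) hKc).integrable_indicator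
      hKc.measurableSet)
  have hab := h.1 _ hKc hcl
  refine ⟨_, fun n => ?_, tendstoUniformlyOn_convolution_indicator hR (hF.mono hcl), ?_, ?_⟩
  · exact (bumpSeq R hR n).hasCompactSupport_normed.contDiff_convolution_right _
      hFi.locallyIntegrable (bumpSeq R hR n).contDiff_normed
  · refine (tendsto_convolution_indicator hR hab.1).congr fun n => eLpNorm_congr_ae ?_
    filter_upwards [ae_restrict_mem Metric.isClosed_closedBall.measurableSet] with z hz
    rw [(dz_convolution_indicator hF h hcl _ (bumpSeq_rOut_lt hR n) hz).1]
  · refine (tendsto_convolution_indicator hR hab.2).congr fun n => eLpNorm_congr_ae ?_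
    filter_upwards [ae_restrict_mem Metric.isClosed_closedBall.measurableSet] with z hz
    rw [(dz_convolution_indicator hF h hcl _ (bumpSeq_rOut_lt hR n) hz).2]

lemma fderiv_apply_eq (F : ℂ → ℂ) (z v : ℂ) :
    fderiv ℝ F z v = dz F z * v + dzbar F z * (starRingEnd ℂ) v := by
  have hv : v = v.re • (1 : ℂ) + v.im • Complex.I := by
    simp [Complex.re_add_im]
  have e : fderiv ℝ F z v = v.re * fderiv ℝ F z 1 + v.im * fderiv ℝ F z Complex.I := by
    conv_lhs => rw [hv]
    rw [map_add, map_smul, map_smul, Complex.real_smul, Complex.real_smul]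
  have e2 : (starRingEnd ℂ) v = v.re - v.im * Complex.I := by
    apply Complex.ext <;> simp
  have e3 : v = v.re + v.im * Complex.I := (Complex.re_add_im v).symm
  rw [e, e2]
  nth_rw 3 [e3]
  simp only [dz, dzbar]
  linear_combination (v.im * fderiv ℝ F z Complex.I : ℂ) * Complex.I_sq

lemma constant_of_weakDeriv_zero {F a b : ℂ → ℂ} {V : Set ℂ} (hF : ContinuousOn F V)
    (h : HasL2WeakDerivOn F V a b) {z₀ : ℂ} {R : ℝ} (hR : 0 < R)
    (hcl : Metric.closedBall z₀ (2 * R) ⊆ V)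
    (ha : ∀ᵐ z, z ∈ Metric.closedBall z₀ (2 * R) → a z = 0)
    (hb : ∀ᵐ z, z ∈ Metric.closedBall z₀ (2 * R) → b z = 0) :
    ∀ z ∈ Metric.ball z₀ R, F z = F z₀ := by
  set K := Metric.closedBall z₀ (2 * R)
  have hz0 : ∀ c : ℂ → ℂ, (∀ᵐ z, z ∈ K → c z = 0) → ∀ (ρ : ℂ → ℝ) z,
      (K.indicator c ⋆[(lsmul ℝ ℝ).flip, volume] ρ) z = 0 := by
    intro c hc ρ z
    rw [convolution_def]
    refine integral_eq_zero_of_ae ?_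
    filter_upwards [hc] with t ht
    by_cases htK : t ∈ K
    · simp [htK, ht htK]
    · simp [htK]
  have hlim := tendstoUniformlyOn_convolution_indicator hR (hF.mono hcl)
  have hKc : IsCompact K := isCompact_closedBall _ _
  have hFi := (((hF.mono hcl).integrableOn_compact (μ := volume) hKc).integrable_indicator
      hKc.measurableSet)
  intro z hz
  have hcst : ∀ n, (K.indicator F ⋆[(lsmul ℝ ℝ).flip, volume] (bumpSeq R hR n).normed volume) z =
      (K.indicator F ⋆[(lsmul ℝ ℝ).flip, volume] (bumpSeq R hR n).normed volume) z₀ := by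
    intro n
    have hd : ContDiff ℝ ∞ (K.indicator F ⋆[(lsmul ℝ ℝ).flip, volume]
        (bumpSeq R hR n).normed volume) :=
      (bumpSeq R hR n).hasCompactSupport_normed.contDiff_convolution_right _
      hFi.locallyIntegrable (bumpSeq R hR n).contDiff_normed
    refine Metric.isOpen_ball.is_const_of_fderiv_eq_zero (𝕜 := ℝ)
      (convex_ball z₀ R).isPreconnected (hd.differentiable (by simp)).differentiableOn ?_ hz
      (Metric.mem_ball_self hR)
    intro x hx
    obtain ⟨e1, e2⟩ := dz_convolution_indicator hF h hcl _ (bumpSeq_rOut_lt hR n)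
      (Metric.ball_subset_closedBall hx)
    ext v
    simp [fderiv_apply_eq, e1, e2, hz0 a ha, hz0 b hb, K]
  have t1 := hlim.tendsto_at (Metric.ball_subset_closedBall hz)
  have t2 := hlim.tendsto_at (Metric.mem_closedBall_self hR.le)
  exact tendsto_nhds_unique t1 (t2.congr fun n => (hcst n).symm)

end NodedQC

namespace NodedQC
open ContinuousLinearMap
open scoped Convolution ComplexConjugate

lemma contDiff_fderiv_apply {u : ℂ → ℂ} (hu : ContDiff ℝ ∞ u) (v : ℂ) :
    ContDiff ℝ ∞ fun z => fderiv ℝ u z v :=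
  (hu.fderiv_right (m := ∞) (by simp)).clm_apply contDiff_const

lemma contDiff_dz {u : ℂ → ℂ} (hu : ContDiff ℝ ∞ u) : ContDiff ℝ ∞ (dz u) :=
  ((contDiff_fderiv_apply hu 1).sub
    (contDiff_const.mul (contDiff_fderiv_apply hu Complex.I))).div_const 2

lemma contDiff_dzbar {u : ℂ → ℂ} (hu : ContDiff ℝ ∞ u) : ContDiff ℝ ∞ (dzbar u) :=
  ((contDiff_fderiv_apply hu 1).add
    (contDiff_const.mul (contDiff_fderiv_apply hu Complex.I))).div_const 2

lemma support_dz_subset (u : ℂ → ℂ) : Function.support (dz u) ⊆ tsupport u := by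
  intro z hz
  by_contra h
  have : fderiv ℝ u z = 0 :=
    image_eq_zero_of_notMem_tsupport fun h' => h (tsupport_fderiv_subset ℝ h')
  exact hz (by simp [dz, this])

lemma support_dzbar_subset (u : ℂ → ℂ) : Function.support (dzbar u) ⊆ tsupport u := by
  intro z hz
  by_contra h
  have : fderiv ℝ u z = 0 :=
    image_eq_zero_of_notMem_tsupport fun h' => h (tsupport_fderiv_subset ℝ h')
  exact hz (by simp [dzbar, this])

lemma dz_dzbar_comm {u : ℂ → ℂ} (hu : ContDiff ℝ ∞ u) : dz (dzbar u) = dzbar (dz u) := by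
  ext z
  have hd : ∀ v w, fderiv ℝ (fun z => fderiv ℝ u z v) z w = fderiv ℝ (fderiv ℝ u) z w v := by
    intro v w
    have hdiff : DifferentiableAt ℝ (fderiv ℝ u) z :=
      ((hu.fderiv_right (m := ∞) (by simp)).differentiable (by simp)).differentiableAt
    rw [fderiv_clm_apply hdiff (differentiableAt_const v)]
    simp
  have hdf : ∀ v, DifferentiableAt ℝ (fun z => fderiv ℝ u z v) z := fun v =>
    ((contDiff_fderiv_apply hu v).differentiable (by simp)).differentiableAt
  have hsymm : fderiv ℝ (fderiv ℝ u) z 1 Complex.I = fderiv ℝ (fderiv ℝ u) z Complex.I 1 :=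
    (hu.contDiffAt.isSymmSndFDerivAt (by simpa using ENat.LEInfty.out)) 1 Complex.I
  have e1 : ∀ v, fderiv ℝ (dzbar u) z v = (fderiv ℝ (fderiv ℝ u) z v 1 +
      Complex.I * fderiv ℝ (fderiv ℝ u) z v Complex.I) / 2 := by
    intro v
    have : HasFDerivAt (dzbar u) ((2 : ℂ)⁻¹ • (fderiv ℝ (fun z => fderiv ℝ u z 1) z +
        Complex.I • fderiv ℝ (fun z => fderiv ℝ u z Complex.I) z)) z := by
      have := ((hdf 1).hasFDerivAt.add ((hdf Complex.I).hasFDerivAt.const_smul Complex.I)).const_smul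
        ((2 : ℂ)⁻¹)
      refine this.congr_of_eventuallyEq (Eventually.of_forall fun x => ?_)
      simp [dzbar]; ring
    rw [this.fderiv]
    simp [hd]; ring
  have e2 : ∀ v, fderiv ℝ (dz u) z v = (fderiv ℝ (fderiv ℝ u) z v 1 -
      Complex.I * fderiv ℝ (fderiv ℝ u) z v Complex.I) / 2 := by
    intro v
    have : HasFDerivAt (dz u) ((2 : ℂ)⁻¹ • (fderiv ℝ (fun z => fderiv ℝ u z 1) z -
        Complex.I • fderiv ℝ (fun z => fderiv ℝ u z Complex.I) z)) z := by
      have := ((hdf 1).hasFDerivAt.sub ((hdf Complex.I).hasFDerivAt.const_smul Complex.I)).const_smul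
        ((2 : ℂ)⁻¹)
      refine this.congr_of_eventuallyEq (Eventually.of_forall fun x => ?_)
      simp [dz]; ring
    rw [this.fderiv]
    simp [hd]; ring
  rw [dz, dzbar, e1, e1, e2, e2, hsymm]
  ring

lemma integral_mul_dzbar_eq {F a b u : ℂ → ℂ} {V : Set ℂ} (h : HasL2WeakDerivOn F V a b)
    (hu : ContDiff ℝ ∞ u) (huc : HasCompactSupport u) (hV : tsupport u ⊆ V) :
    ∫ z, a z * dzbar u z = ∫ z, b z * dz u z := by
  have s1 : tsupport (dz u) ⊆ tsupport u := closure_minimal (support_dz_subset u) (isClosed_tsupport u)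
  have s2 : tsupport (dzbar u) ⊆ tsupport u :=
    closure_minimal (support_dzbar_subset u) (isClosed_tsupport u)
  have h1 := (h.2 _ (contDiff_dzbar hu) (huc.mono' (support_dzbar_subset u)) (s2.trans hV)).1
  have h2 := (h.2 _ (contDiff_dz hu) (huc.mono' (support_dz_subset u)) (s1.trans hV)).2
  rw [dz_dzbar_comm hu] at h1
  exact neg_inj.1 (h1.symm.trans h2)

lemma dz_mul {u v : ℂ → ℂ} {z : ℂ} (hu : DifferentiableAt ℝ u z) (hv : DifferentiableAt ℝ v z) :
    dz (fun z => u z * v z) z = dz u z * v z + u z * dz v z := by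
  simp only [dz, fderiv_fun_mul hu hv]
  simp; ring

lemma dzbar_mul {u v : ℂ → ℂ} {z : ℂ} (hu : DifferentiableAt ℝ u z)
    (hv : DifferentiableAt ℝ v z) :
    dzbar (fun z => u z * v z) z = dzbar u z * v z + u z * dzbar v z := by
  simp only [dzbar, fderiv_fun_mul hu hv]
  simp; ring

lemma dz_comp {η F : ℂ → ℂ} {z : ℂ} (hη : DifferentiableAt ℝ η (F z))
    (hF : DifferentiableAt ℝ F z) :
    dz (fun z => η (F z)) z = dz η (F z) * dz F z + dzbar η (F z) * conj (dzbar F z) := by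
  have : ∀ v, fderiv ℝ (fun z => η (F z)) z v = fderiv ℝ η (F z) (fderiv ℝ F z v) := by
    intro v
    rw [show (fun z => η (F z)) = η ∘ F from rfl, fderiv_comp z hη hF]; rfl
  rw [dz, this, this, fderiv_apply_eq η, fderiv_apply_eq η, fderiv_apply_eq F, fderiv_apply_eq F]
  simp only [map_add, map_mul, Complex.conj_I, map_neg, map_one, mul_one]
  linear_combination (-(dz η (F z) * dz F z + dzbar η (F z) * conj (dzbar F z)) / 2 +
    (dz η (F z) * dzbar F z + dzbar η (F z) * conj (dz F z)) / 2) * Complex.I_sq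

lemma dzbar_comp {η F : ℂ → ℂ} {z : ℂ} (hη : DifferentiableAt ℝ η (F z))
    (hF : DifferentiableAt ℝ F z) :
    dzbar (fun z => η (F z)) z = dz η (F z) * dzbar F z + dzbar η (F z) * conj (dz F z) := by
  have : ∀ v, fderiv ℝ (fun z => η (F z)) z v = fderiv ℝ η (F z) (fderiv ℝ F z v) := by
    intro v
    rw [show (fun z => η (F z)) = η ∘ F from rfl, fderiv_comp z hη hF]; rfl
  rw [dzbar, this, this, fderiv_apply_eq η, fderiv_apply_eq η, fderiv_apply_eq F, fderiv_apply_eq F]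
  simp only [map_add, map_mul, Complex.conj_I, map_neg, map_one, mul_one]
  linear_combination ((dz η (F z) * dz F z + dzbar η (F z) * conj (dzbar F z)) / 2 -
    (dz η (F z) * dzbar F z + dzbar η (F z) * conj (dz F z)) / 2) * Complex.I_sq

/-- Eventually integrable functions whose integrals converge to that of an integrable function. -/
structure IntegralTendsto (m : Measure ℂ) (P : ℕ → ℂ → ℂ) (Q : ℂ → ℂ) : Prop where
  eventually_integrable : ∀ᶠ n in atTop, Integrable (P n) m
  integrable : Integrable Q m
  tendsto : Tendsto (fun n => ∫ z, P n z ∂m) atTop (𝓝 (∫ z, Q z ∂m))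

lemma IntegralTendsto.add {m : Measure ℂ} {P P' : ℕ → ℂ → ℂ} {Q Q' : ℂ → ℂ}
    (h : IntegralTendsto m P Q) (h' : IntegralTendsto m P' Q') :
    IntegralTendsto m (fun n z => P n z + P' n z) fun z => Q z + Q' z where
  eventually_integrable := by
    filter_upwards [h.1, h'.1] with n h1 h2 using h1.add h2
  integrable := h.2.add h'.2
  tendsto := by
    rw [integral_add h.2 h'.2]
    refine (h.3.add h'.3).congr' ?_
    filter_upwards [h.1, h'.1] with n h1 h2 using (integral_add h1 h2).symm

lemma IntegralTendsto.sub {m : Measure ℂ} {P P' : ℕ → ℂ → ℂ} {Q Q' : ℂ → ℂ}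
    (h : IntegralTendsto m P Q) (h' : IntegralTendsto m P' Q') :
    IntegralTendsto m (fun n z => P n z - P' n z) fun z => Q z - Q' z where
  eventually_integrable := by
    filter_upwards [h.1, h'.1] with n h1 h2 using h1.sub h2
  integrable := h.2.sub h'.2
  tendsto := by
    rw [integral_sub h.2 h'.2]
    refine (h.3.sub h'.3).congr' ?_
    filter_upwards [h.1, h'.1] with n h1 h2 using (integral_sub h1 h2).symm

/-- Continuous, eventually uniformly bounded functions on `K` that converge pointwise. -/
structure BoundedTendstoOn (K : Set ℂ) (X : ℕ → ℂ → ℂ) (Y : ℂ → ℂ) : Prop where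
  continuousOn : ∀ n, ContinuousOn (X n) K
  tendsto : ∀ z ∈ K, Tendsto (fun n => X n z) atTop (𝓝 (Y z))
  bounded : ∃ C : ℝ, ∀ᶠ n in atTop, ∀ z ∈ K, ‖X n z‖ ≤ C

lemma BoundedTendstoOn.mul {K : Set ℂ} {X X' : ℕ → ℂ → ℂ} {Y Y' : ℂ → ℂ}
    (h : BoundedTendstoOn K X Y) (h' : BoundedTendstoOn K X' Y') :
    BoundedTendstoOn K (fun n z => X n z * X' n z) fun z => Y z * Y' z where
  continuousOn n := (h.1 n).mul (h'.1 n)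
  tendsto z hz := (h.2 z hz).mul (h'.2 z hz)
  bounded := by
    obtain ⟨C, hC⟩ := h.3
    obtain ⟨C', hC'⟩ := h'.3
    refine ⟨C * C', ?_⟩
    filter_upwards [hC, hC'] with n h1 h2 z hz
    rw [norm_mul]
    exact mul_le_mul (h1 z hz) (h2 z hz) (norm_nonneg _) ((norm_nonneg _).trans (h1 z hz))

lemma BoundedTendstoOn.const {K : Set ℂ} (hK : IsCompact K) {X : ℂ → ℂ} (hX : ContinuousOn X K) :
    BoundedTendstoOn K (fun _ => X) X where
  continuousOn _ := hX
  tendsto _ _ := tendsto_const_nhds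
  bounded := by
    obtain ⟨C, hC⟩ := hK.exists_bound_of_continuousOn hX
    exact ⟨C, Eventually.of_forall fun _ => hC⟩

lemma BoundedTendstoOn.of_uniform {K : Set ℂ} (hK : IsCompact K) {X : ℕ → ℂ → ℂ} {Y : ℂ → ℂ}
    (hX : ∀ n, Continuous (X n)) (hY : ContinuousOn Y K) (h : TendstoUniformlyOn X Y atTop K) :
    BoundedTendstoOn K X Y where
  continuousOn n := (hX n).continuousOn
  tendsto _ hz := h.tendsto_at hz
  bounded := by
    obtain ⟨C, hC⟩ := hK.exists_bound_of_continuousOn hY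
    refine ⟨C + 1, ?_⟩
    filter_upwards [Metric.tendstoUniformlyOn_iff.1 h 1 one_pos] with n hn z hz
    have h1 := hn z hz
    rw [dist_comm, dist_eq_norm] at h1
    calc ‖X n z‖ = ‖Y z + (X n z - Y z)‖ := by ring_nf
      _ ≤ ‖Y z‖ + ‖X n z - Y z‖ := norm_add_le _ _
      _ ≤ C + 1 := add_le_add (hC z hz) h1.le

lemma BoundedTendstoOn.comp {K : Set ℂ} {X : ℕ → ℂ → ℂ} {Y : ℂ → ℂ} (h : BoundedTendstoOn K X Y)
    {η : ℂ → ℂ} (hη : Continuous η) (hc : HasCompactSupport η) :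
    BoundedTendstoOn K (fun n z => η (X n z)) fun z => η (Y z) where
  continuousOn n := hη.comp_continuousOn (h.1 n)
  tendsto z hz := (hη.tendsto _).comp (h.2 z hz)
  bounded := by
    obtain ⟨C, hC⟩ := hη.bounded_above_of_compact_support hc
    exact ⟨C, Eventually.of_forall fun _ _ _ => hC _⟩

lemma eLpNorm_mul_le_two {m : Measure ℂ} {Y Z : ℂ → ℂ} (hY : AEStronglyMeasurable Y m)
    (hZ : AEStronglyMeasurable Z m) :
    eLpNorm (fun z => Y z * Z z) 1 m ≤ eLpNorm Y 2 m * eLpNorm Z 2 m :=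
  eLpNorm_smul_le_mul_eLpNorm (p := 2) (q := 2) (r := 1) (φ := Y) (f := Z) hZ hY

lemma integralTendsto_mul {K : Set ℂ} (hK : IsCompact K) {X : ℕ → ℂ → ℂ} {X₀ : ℂ → ℂ}
    (hX : BoundedTendstoOn K X X₀) {Y : ℕ → ℂ → ℂ} {Y₀ Z : ℂ → ℂ}
    (hY : ∀ n, MemLp (Y n) 2 (volume.restrict K)) (hY₀ : MemLp Y₀ 2 (volume.restrict K))
    (hZ : MemLp Z 2 (volume.restrict K))
    (hYt : Tendsto (fun n => eLpNorm (fun z => Y n z - Y₀ z) 2 (volume.restrict K)) atTop (𝓝 0)) :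
    IntegralTendsto (volume.restrict K) (fun n z => X n z * (Y n z * Z z))
      fun z => X₀ z * (Y₀ z * Z z) := by
  have hKm := hK.measurableSet
  have hXm : ∀ n, AEStronglyMeasurable (X n) (volume.restrict K) := fun n =>
    (hX.1 n).aestronglyMeasurable hKm
  have hX0m : AEStronglyMeasurable X₀ (volume.restrict K) :=
    aestronglyMeasurable_of_tendsto_ae atTop hXm (by
      filter_upwards [ae_restrict_mem hKm] with z hz using hX.2 z hz)
  obtain ⟨C, hC⟩ := hX.3
  have hX0 : ∀ z ∈ K, ‖X₀ z‖ ≤ C := fun z hz =>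
    le_of_tendsto (hX.2 z hz).norm (hC.mono fun n hn => hn z hz)
  have hYZ : Integrable (fun z => Y₀ z * Z z) (volume.restrict K) := hY₀.integrable_mul hZ
  have hYnZ : ∀ n, Integrable (fun z => Y n z * Z z) (volume.restrict K) := fun n =>
    (hY n).integrable_mul hZ
  have hlim : Tendsto (fun n => ∫ z in K, X n z * (Y₀ z * Z z)) atTop
      (𝓝 (∫ z in K, X₀ z * (Y₀ z * Z z))) := by
    refine tendsto_integral_filter_of_dominated_convergence (fun z => C * ‖Y₀ z * Z z‖)
      (Eventually.of_forall fun n => (hXm n).mul hYZ.1) ?_ (hYZ.norm.const_mul C) ?_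
    · filter_upwards [hC] with n hn
      filter_upwards [ae_restrict_mem hKm] with z hz
      rw [norm_mul]
      exact mul_le_mul_of_nonneg_right (hn z hz) (norm_nonneg _)
    · filter_upwards [ae_restrict_mem hKm] with z hz using (hX.2 z hz).mul_const _
  have hbd : ∀ {W : ℂ → ℂ} {n}, (∀ z ∈ K, ‖X n z‖ ≤ C) → Integrable W (volume.restrict K) →
      Integrable (fun z => X n z * W z) (volume.restrict K) := by
    intro W n hn hW
    refine hW.bdd_mul (hXm n) (c := C) ?_
    filter_upwards [ae_restrict_mem hKm] with z hz using hn z hz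
  have hdiff : Tendsto (fun n => ∫ z in K, X n z * ((Y n z - Y₀ z) * Z z)) atTop (𝓝 0) := by
    rw [tendsto_zero_iff_enorm_tendsto_zero]
    have hb : Tendsto (fun n => ENNReal.ofReal C *
        (eLpNorm (fun z => Y n z - Y₀ z) 2 (volume.restrict K) * eLpNorm Z 2 (volume.restrict K)))
        atTop (𝓝 0) := by
      have h1 := ENNReal.Tendsto.mul_const hYt (b := eLpNorm Z 2 (volume.restrict K))
        (Or.inr hZ.2.ne)
      have h2 := ENNReal.Tendsto.const_mul h1 (a := ENNReal.ofReal C) (Or.inr (by simp))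
      simpa using h2
    refine tendsto_of_tendsto_of_tendsto_of_le_of_le' tendsto_const_nhds hb
      (Eventually.of_forall fun n => by simp) ?_
    filter_upwards [hC] with n hn
    refine (enorm_integral_le_lintegral_enorm _).trans ?_
    calc _ ≤ ∫⁻ z in K, ENNReal.ofReal C * ‖(Y n z - Y₀ z) * Z z‖ₑ := by
          refine setLIntegral_mono_ae' hKm (ae_of_all _ fun z hz => ?_)
          rw [enorm_mul]
          gcongr
          rw [← ofReal_norm]
          exact ENNReal.ofReal_le_ofReal (hn z hz)
      _ = ENNReal.ofReal C * eLpNorm (fun z => (Y n z - Y₀ z) * Z z) 1 (volume.restrict K) := by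
          rw [lintegral_const_mul' _ _ (by simp), eLpNorm_one_eq_lintegral_enorm]
      _ ≤ _ := by
          gcongr
          exact eLpNorm_mul_le_two ((hY n).1.sub hY₀.1) hZ.1
  refine ⟨?_, ?_, ?_⟩
  · filter_upwards [hC] with n hn using hbd hn (hYnZ n)
  · refine hYZ.bdd_mul hX0m (c := C) ?_
    filter_upwards [ae_restrict_mem hKm] with z hz using hX0 z hz
  · have := hdiff.add hlim
    rw [zero_add] at this
    refine this.congr' ?_
    filter_upwards [hC] with n hn
    rw [← integral_add]
    · refine integral_congr_ae (ae_of_all _ fun z => ?_)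
      simp only; ring
    · exact hbd hn (((hY n).sub hY₀).integrable_mul hZ)
    · exact hbd hn hYZ

end NodedQC

namespace NodedQC
open ContinuousLinearMap
open scoped Convolution ComplexConjugate

lemma memLp_two_of_continuous {K : Set ℂ} (hK : IsCompact K) {X : ℂ → ℂ} (hX : Continuous X) :
    MemLp X 2 (volume.restrict K) := by
  obtain ⟨C, hC⟩ := hK.exists_bound_of_continuousOn hX.continuousOn
  have : IsFiniteMeasure (volume.restrict K) := ⟨by simpa using hK.measure_lt_top⟩
  exact MemLp.of_bound hX.aestronglyMeasurable C
    ((ae_restrict_mem hK.measurableSet).mono fun z hz => hC z hz)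

lemma memLp_conj {m : Measure ℂ} {X : ℂ → ℂ} (hX : MemLp X 2 m) :
    MemLp (fun z => conj (X z)) 2 m :=
  hX.congr_norm (Complex.continuous_conj.comp_aestronglyMeasurable hX.1)
    (ae_of_all _ fun z => by simp)

lemma integral_pullback_eq_zero {f g a b a' b' : ℂ → ℂ} {V : Set ℂ} (hf : ContinuousOn f V)
    (hg : ContinuousOn g V) (hfw : HasL2WeakDerivOn f V a b) (hgw : HasL2WeakDerivOn g V a' b')
    {z₀ : ℂ} {R : ℝ} (hR : 0 < R) (hcl : Metric.closedBall z₀ (2 * R) ⊆ V)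
    {θ η : ℂ → ℂ} (hθ : ContDiff ℝ ∞ θ) (hθs : tsupport θ ⊆ Metric.closedBall z₀ R)
    (hη : ContDiff ℝ ∞ η) (hηc : HasCompactSupport η) :
    Integrable (fun z => (g z * η (f z)) * (a z * dzbar θ z - b z * dz θ z) +
      θ z * η (f z) * (a z * b' z - b z * a' z) +
      θ z * g z * dzbar η (f z) * (a z * conj (a z) - b z * conj (b z)))
      (volume.restrict (Metric.closedBall z₀ R)) ∧
    ∫ z in Metric.closedBall z₀ R, ((g z * η (f z)) * (a z * dzbar θ z - b z * dz θ z) +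
      θ z * η (f z) * (a z * b' z - b z * a' z) +
      θ z * g z * dzbar η (f z) * (a z * conj (a z) - b z * conj (b z))) = 0 := by
  set K := Metric.closedBall z₀ R
  have hKc : IsCompact K := isCompact_closedBall _ _
  have hKV : K ⊆ V := (Metric.closedBall_subset_closedBall (by linarith)).trans hcl
  obtain ⟨F, hF, hFu, hFa, hFb⟩ := exists_smooth_approx hf hfw hR hcl
  obtain ⟨G, hG, hGu, hGa, hGb⟩ := exists_smooth_approx hg hgw hR hcl
  obtain ⟨ha, hb⟩ := hfw.1 K hKc hKV
  obtain ⟨ha', hb'⟩ := hgw.1 K hKc hKV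
  have bF : BoundedTendstoOn K F f :=
    .of_uniform hKc (fun n => (hF n).continuous) (hf.mono hKV) hFu
  have bG : BoundedTendstoOn K G g :=
    .of_uniform hKc (fun n => (hG n).continuous) (hg.mono hKV) hGu
  have bη : BoundedTendstoOn K (fun n z => η (F n z)) fun z => η (f z) :=
    bF.comp hη.continuous hηc
  have bη1 : BoundedTendstoOn K (fun n z => dz η (F n z)) fun z => dz η (f z) :=
    bF.comp (contDiff_dz hη).continuous (hηc.mono' (support_dz_subset η))
  have bη2 : BoundedTendstoOn K (fun n z => dzbar η (F n z)) fun z => dzbar η (f z) :=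
    bF.comp (contDiff_dzbar hη).continuous (hηc.mono' (support_dzbar_subset η))
  have bθ : BoundedTendstoOn K (fun _ => θ) θ := .const hKc hθ.continuous.continuousOn
  have bθ1 : BoundedTendstoOn K (fun _ => dz θ) (dz θ) :=
    .const hKc (contDiff_dz hθ).continuous.continuousOn
  have bθ2 : BoundedTendstoOn K (fun _ => dzbar θ) (dzbar θ) :=
    .const hKc (contDiff_dzbar hθ).continuous.continuousOn
  have m1 : MemLp (fun _ : ℂ => (1 : ℂ)) 2 (volume.restrict K) :=
    memLp_two_of_continuous hKc continuous_const
  have mz : ∀ {u : ℂ → ℂ}, ContDiff ℝ ∞ u → MemLp (dz u) 2 (volume.restrict K) := fun hu =>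
    memLp_two_of_continuous hKc (contDiff_dz hu).continuous
  have mzb : ∀ {u : ℂ → ℂ}, ContDiff ℝ ∞ u → MemLp (dzbar u) 2 (volume.restrict K) := fun hu =>
    memLp_two_of_continuous hKc (contDiff_dzbar hu).continuous
  have hconj : ∀ {W : ℕ → ℂ → ℂ} {w : ℂ → ℂ},
      Tendsto (fun n => eLpNorm (fun z => W n z - w z) 2 (volume.restrict K)) atTop (𝓝 0) →
      Tendsto (fun n => eLpNorm (fun z => conj (W n z) - conj (w z)) 2 (volume.restrict K))
        atTop (𝓝 0) := by
    intro W w h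
    refine h.congr fun n => eLpNorm_congr_norm_ae (ae_of_all _ fun z => ?_)
    rw [← map_sub, RCLike.norm_conj]
  have h11 : Tendsto (fun _ : ℕ => eLpNorm (fun _ : ℂ => (1 : ℂ) - 1) 2 (volume.restrict K))
      atTop (𝓝 0) := by simp
  have A1 := integralTendsto_mul hKc (bθ2.mul (bG.mul bη)) (fun _ => m1) m1 ha h11
  have A2 := integralTendsto_mul hKc (bθ.mul bη) (fun n => mzb (hG n)) hb' ha hGb
  have A3 := integralTendsto_mul hKc (bθ.mul (bG.mul bη1)) (fun n => mzb (hF n)) hb ha hFb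
  have A4 := integralTendsto_mul hKc (bθ.mul (bG.mul bη2)) (fun n => memLp_conj (mz (hF n)))
    (memLp_conj ha) ha (hconj hFa)
  have B1 := integralTendsto_mul hKc (bθ1.mul (bG.mul bη)) (fun _ => m1) m1 hb h11
  have B2 := integralTendsto_mul hKc (bθ.mul bη) (fun n => mz (hG n)) ha' hb hGa
  have B3 := integralTendsto_mul hKc (bθ.mul (bG.mul bη1)) (fun n => mz (hF n)) ha hb hFa
  have B4 := integralTendsto_mul hKc (bθ.mul (bG.mul bη2)) (fun n => memLp_conj (mzb (hF n)))
    (memLp_conj hb) hb (hconj hFb)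
  have A := ((A1.add A2).add A3).add A4
  have B := ((B1.add B2).add B3).add B4
  have T := A.sub B
  have hQ : ∀ z, _ = (g z * η (f z)) * (a z * dzbar θ z - b z * dz θ z) +
      θ z * η (f z) * (a z * b' z - b z * a' z) +
      θ z * g z * dzbar η (f z) * (a z * conj (a z) - b z * conj (b z)) := fun z =>
    show (dzbar θ z * (g z * η (f z)) * (1 * a z) + θ z * η (f z) * (b' z * a z) +
      θ z * (g z * dz η (f z)) * (b z * a z) + θ z * (g z * dzbar η (f z)) * (conj (a z) * a z)) -
      (dz θ z * (g z * η (f z)) * (1 * b z) + θ z * η (f z) * (a' z * b z) +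
      θ z * (g z * dz η (f z)) * (a z * b z) + θ z * (g z * dzbar η (f z)) * (conj (b z) * b z)) = _
      by ring
  refine ⟨T.integrable.congr (ae_of_all _ hQ), ?_⟩
  rw [← integral_congr_ae (ae_of_all _ hQ)]
  refine tendsto_nhds_unique T.tendsto (tendsto_const_nhds.congr' ?_)
  filter_upwards [A.eventually_integrable, B.eventually_integrable] with n hA hB
  rw [integral_sub hA hB, eq_comm, sub_eq_zero]
  have dθ := fun z => (hθ.differentiable (by simp)).differentiableAt (x := z)
  have dη := fun z => (hη.differentiable (by simp)).differentiableAt (x := z)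
  have dF := fun z => ((hF n).differentiable (by simp)).differentiableAt (x := z)
  have dG := fun z => ((hG n).differentiable (by simp)).differentiableAt (x := z)
  have hηF : ContDiff ℝ ∞ fun z => η (F n z) := hη.comp (hF n)
  have dηF := fun z => (hηF.differentiable (by simp)).differentiableAt (x := z)
  have hGη : ContDiff ℝ ∞ fun z => G n z * η (F n z) := (hG n).mul hηF
  have dGη := fun z => (hGη.differentiable (by simp)).differentiableAt (x := z)
  set u : ℂ → ℂ := fun z => θ z * (G n z * η (F n z))
  have hu : ContDiff ℝ ∞ u := hθ.mul hGη
  have hus : tsupport u ⊆ K := (closure_mono (Function.support_mul_subset_left θ _)).trans hθs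
  have key := integral_mul_dzbar_eq hfw hu
    (HasCompactSupport.of_support_subset_isCompact hKc (subset_closure.trans hus)) (hus.trans hKV)
  have i1 : ∫ z in K, a z * dzbar u z = ∫ z, a z * dzbar u z := by
    refine setIntegral_eq_integral_of_forall_compl_eq_zero fun z hz => ?_
    rw [Function.notMem_support.1 fun h => hz (hus (support_dzbar_subset u h)), mul_zero]
  have i2 : ∫ z in K, b z * dz u z = ∫ z, b z * dz u z := by
    refine setIntegral_eq_integral_of_forall_compl_eq_zero fun z hz => ?_
    rw [Function.notMem_support.1 fun h => hz (hus (support_dz_subset u h)), mul_zero]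
  rw [← i1, ← i2] at key
  refine Eq.trans (integral_congr_ae (ae_of_all _ fun z => ?_)) (key.trans
    (integral_congr_ae (ae_of_all _ fun z => ?_)))
  · simp only [u]
    rw [dzbar_mul (dθ z) (dGη z), dzbar_mul (dG z) (dηF z), dzbar_comp (dη _) (dF z)]
    ring
  · simp only [u]
    rw [dz_mul (dθ z) (dGη z), dz_mul (dG z) (dηF z), dz_comp (dη _) (dF z)]
    ring

end NodedQC

namespace NodedQC
open ContinuousLinearMap
open scoped Convolution ComplexConjugate

lemma integral_fderiv_apply_eq_zero {φ : ℂ → ℂ} (hφ : ContDiff ℝ ∞ φ) (hc : HasCompactSupport φ)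
    (v : ℂ) : ∫ z, fderiv ℝ φ z v = 0 := by
  have hi : Integrable (fun z => fderiv ℝ φ z v) volume :=
    (contDiff_fderiv_apply hφ v).continuous.integrable_of_hasCompactSupport
      ((hc.fderiv ℝ).comp_left (g := fun L : ℂ →L[ℝ] ℂ => L v) rfl)
  have := integral_mul_fderiv_eq_neg_fderiv_mul_of_integrable (μ := (volume : Measure ℂ)) (𝕜 := ℂ)
    (f := fun _ : ℂ => (1 : ℂ)) (g := φ) (v := v) (by simp) (by simpa using hi)
    (by simpa using hφ.continuous.integrable_of_hasCompactSupport hc)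
    (fun _ _ => differentiableAt_const _)
    fun _ _ => (hφ.differentiable (by simp)).differentiableAt
  simpa using this

lemma hasL2WeakDerivOn_one (V : Set ℂ) : HasL2WeakDerivOn (fun _ => 1) V 0 0 := by
  refine ⟨fun K _ _ => ⟨MemLp.zero, MemLp.zero⟩, fun φ hφ hc _ => ?_⟩
  have hi : ∀ v, Integrable (fun z => fderiv ℝ φ z v) volume := fun v =>
    (contDiff_fderiv_apply hφ v).continuous.integrable_of_hasCompactSupport
      ((hc.fderiv ℝ).comp_left (g := fun L : ℂ →L[ℝ] ℂ => L v) rfl)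
  constructor
  · simp only [one_mul, dz]
    rw [integral_div, integral_sub (hi 1) ((hi Complex.I).const_mul _), integral_const_mul,
      integral_fderiv_apply_eq_zero hφ hc, integral_fderiv_apply_eq_zero hφ hc]
    simp
  · simp only [one_mul, dzbar]
    rw [integral_div, integral_add (hi 1) ((hi Complex.I).const_mul _), integral_const_mul,
      integral_fderiv_apply_eq_zero hφ hc, integral_fderiv_apply_eq_zero hφ hc]
    simp

lemma fderiv_comp_sub_const (χ : ℂ → ℂ) (w t : ℂ) :
    fderiv ℝ (fun w => χ (w - t)) w = fderiv ℝ χ (w - t) := by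
  exact fderiv_comp_sub (𝕜 := ℝ) (f := χ) (x := w) t

/-- A smoothed push-forward `t ↦ ∫ W(z) χ(f(z) - t)` is holomorphic at `t` as soon as the
`∂̄`-derivative of the kernel integrates to zero. -/
lemma differentiableAt_integral_kernel {m : Measure ℂ} {W f χ : ℂ → ℂ} (hW : Integrable W m)
    (hf : AEStronglyMeasurable f m) (hχ : ContDiff ℝ ∞ χ) (hχc : HasCompactSupport χ) (t : ℂ)
    (h : ∫ z, W z * dzbar χ (f z - t) ∂m = 0) :
    DifferentiableAt ℂ (fun t => ∫ z, W z * χ (f z - t) ∂m) t := by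
  obtain ⟨C, hC⟩ := hχ.continuous.bounded_above_of_compact_support hχc
  have hdc : Continuous (fderiv ℝ χ) := hχ.continuous_fderiv (by simp)
  obtain ⟨C', hC'⟩ := hdc.bounded_above_of_compact_support (hχc.fderiv ℝ)
  have hft : ∀ s, AEStronglyMeasurable (fun z => f z - s) m := fun s =>
    hf.sub aestronglyMeasurable_const
  have hD : HasFDerivAt (fun t => ∫ z, W z * χ (f z - t) ∂m)
      (∫ z, W z • -(fderiv ℝ χ (f z - t)) ∂m) t := by
    refine hasFDerivAt_integral_of_dominated_of_fderiv_le (F := fun t z => W z * χ (f z - t))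
      (F' := fun t z => W z • -(fderiv ℝ χ (f z - t))) (bound := fun z => ‖W z‖ * C')
      (s := univ) univ_mem ?_ ?_ ?_ ?_ ?_ ?_
    · exact Eventually.of_forall fun s =>
        hW.1.mul (hχ.continuous.comp_aestronglyMeasurable (hft s))
    · exact hW.mul_bdd (c := C) (hχ.continuous.comp_aestronglyMeasurable (hft t))
        (ae_of_all _ fun z => hC _)
    · exact hW.1.smul (hdc.comp_aestronglyMeasurable (hft t)).neg
    · refine ae_of_all _ fun z s _ => ?_
      rw [norm_smul, norm_neg]
      exact mul_le_mul_of_nonneg_left (hC' _) (norm_nonneg _)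
    · exact hW.norm.mul_const _
    · refine ae_of_all _ fun z s _ => ?_
      have h1 : HasFDerivAt χ (fderiv ℝ χ (f z - s)) (f z - s) :=
        (hχ.differentiable (by simp)).differentiableAt.hasFDerivAt
      have h2 : HasFDerivAt (fun s : ℂ => f z - s) (-(ContinuousLinearMap.id ℝ ℂ)) s := by
        simpa using (hasFDerivAt_id (𝕜 := ℝ) s).const_sub (f z)
      have h3 := (h1.comp s h2).const_smul (W z)
      refine h3.congr_fderiv ?_
      ext v
      simp
  have hint : Integrable (fun z => W z • -(fderiv ℝ χ (f z - t))) m := by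
    refine (hW.norm.mul_const C').mono' (hW.1.smul (hdc.comp_aestronglyMeasurable (hft t)).neg)
      (ae_of_all _ fun z => ?_)
    rw [norm_smul, norm_neg]
    exact mul_le_mul_of_nonneg_left (hC' _) (norm_nonneg _)
  rw [differentiableAt_complex_iff_differentiableAt_real]
  refine ⟨hD.differentiableAt, ?_⟩
  rw [hD.fderiv, ContinuousLinearMap.integral_apply hint, ContinuousLinearMap.integral_apply hint,
    smul_eq_mul, ← integral_const_mul, ← sub_eq_zero, ← integral_sub]
  · have e : ∀ z, (W z • -(fderiv ℝ χ (f z - t))) Complex.I -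
        Complex.I * (W z • -(fderiv ℝ χ (f z - t))) 1 =
        (2 * Complex.I) * (W z * dzbar χ (f z - t)) := by
      intro z
      simp only [dzbar, smul_apply, neg_apply, smul_eq_mul]
      linear_combination (-(W z * fderiv ℝ χ (f z - t) Complex.I)) * Complex.I_sq
    simp only [e]
    rw [integral_const_mul, h, mul_zero]
  · exact hint.apply_continuousLinearMap _
  · exact (hint.apply_continuousLinearMap _).const_mul _

lemma integral_mul_dzbar_comp_eq_zero {f g a b a' b' μ : ℂ → ℂ} {V : Set ℂ}
    (hf : ContinuousOn f V) (hg : ContinuousOn g V) (hfw : HasL2WeakDerivOn f V a b)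
    (hgw : HasL2WeakDerivOn g V a' b') (hb : ∀ᵐ z, z ∈ V → b z = μ z * a z)
    (hb' : ∀ᵐ z, z ∈ V → b' z = μ z * a' z)
    {z₀ : ℂ} {R : ℝ} (hR : 0 < R) (hcl : Metric.closedBall z₀ (2 * R) ⊆ V)
    {S : Set ℂ} (hS : ∀ z ∈ V, f z ∈ S → z ∈ Metric.ball z₀ (R / 2))
    {η : ℂ → ℂ} (hη : ContDiff ℝ ∞ η) (hηc : HasCompactSupport η) (hηS : tsupport η ⊆ S) :
    ∫ z in Metric.closedBall z₀ R, g z * (a z * conj (a z) - b z * conj (b z)) *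
      dzbar η (f z) = 0 := by
  let θ : ContDiffBump z₀ := ⟨R / 2, R, by positivity, by linarith⟩
  have hθ : ContDiff ℝ ∞ (fun z => ((θ z : ℝ) : ℂ)) :=
    Complex.ofRealCLM.contDiff.comp θ.contDiff
  have hθs : tsupport (fun z => ((θ z : ℝ) : ℂ)) ⊆ Metric.closedBall z₀ R := by
    refine closure_minimal (fun z hz => ?_) Metric.isClosed_closedBall
    have : z ∈ Function.support θ := fun h0 => hz (by simp [h0])
    rw [θ.support_eq] at this
    exact Metric.ball_subset_closedBall this
  have key := (integral_pullback_eq_zero hf hg hfw hgw hR hcl hθ hθs hη hηc).2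
  rw [← key]
  have hKV : Metric.closedBall z₀ R ⊆ V :=
    (Metric.closedBall_subset_closedBall (by linarith)).trans hcl
  refine integral_congr_ae ?_
  filter_upwards [ae_restrict_mem Metric.isClosed_closedBall.measurableSet,
    ae_restrict_of_ae hb, ae_restrict_of_ae hb'] with z hz h1 h2
  have hzV := hKV hz
  by_cases hzS : f z ∈ S
  · have hzb := hS z hzV hzS
    have hloc : (fun z => ((θ z : ℝ) : ℂ)) =ᶠ[𝓝 z] fun _ => 1 := by
      filter_upwards [θ.eventuallyEq_one_of_mem_ball hzb] with x hx
      simp [hx]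
    have hfd : fderiv ℝ (fun z => ((θ z : ℝ) : ℂ)) z = 0 := by
      rw [hloc.fderiv_eq]; simp
    have hone : ((θ z : ℝ) : ℂ) = 1 := hloc.eq_of_nhds
    rw [h1 hzV, h2 hzV, hone]
    simp only [dz, dzbar, hfd]
    simp
    ring
  · have e1 : η (f z) = 0 := image_eq_zero_of_notMem_tsupport fun h => hzS (hηS h)
    have e2 : dzbar η (f z) = 0 :=
      Function.notMem_support.1 fun h => hzS (hηS (support_dzbar_subset η h))
    simp [e1, e2]

lemma tsupport_translate_subset {χ : ContDiffBump (0 : ℂ)} {t w₀ : ℂ} {ρ : ℝ}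
    (hχ : χ.rOut < ρ) (ht : t ∈ Metric.ball w₀ ρ) :
    tsupport (fun w => ((χ (w - t) : ℝ) : ℂ)) ⊆ Metric.closedBall w₀ (2 * ρ) := by
  refine closure_minimal (fun w hw => ?_) Metric.isClosed_closedBall
  have : w - t ∈ Function.support χ := fun h0 => hw (by simp [h0])
  rw [χ.support_eq, mem_ball_zero_iff, ← dist_eq_norm] at this
  rw [Metric.mem_ball] at ht
  rw [Metric.mem_closedBall]
  linarith [dist_triangle w t w₀]

lemma jacobian_nonneg {a b m : ℂ} (hb : b = m * a) (hm : ‖m‖ < 1) :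
    0 ≤ ‖a‖ ^ 2 - ‖b‖ ^ 2 ∧ (‖a‖ ^ 2 - ‖b‖ ^ 2 = 0 → a = 0 ∧ b = 0) := by
  have e : ‖a‖ ^ 2 - ‖b‖ ^ 2 = (1 - ‖m‖ ^ 2) * ‖a‖ ^ 2 := by rw [hb, norm_mul]; ring
  have h1 : 0 < 1 - ‖m‖ ^ 2 := by nlinarith [norm_nonneg m]
  rw [e]
  refine ⟨by positivity, fun h => ?_⟩
  have ha : a = 0 := by
    rcases mul_eq_zero.1 h with h | h
    · exact absurd h h1.ne'
    · simpa using h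
  exact ⟨ha, by rw [hb, ha, mul_zero]⟩

/-- Two solutions of the same Beltrami equation, the first one injective and open, differ by a
holomorphic map. -/
theorem differentiableAt_of_solves_same_beltrami {f g h a b a' b' μ : ℂ → ℂ} {V : Set ℂ}
    (hV : IsOpen V) (hf : ContinuousOn f V) (hg : ContinuousOn g V) (hinj : InjOn f V)
    (hopen : ∀ O ⊆ V, IsOpen O → IsOpen (f '' O)) (hh : ContinuousOn h (f '' V))
    (hhf : ∀ z ∈ V, h (f z) = g z) (hfw : HasL2WeakDerivOn f V a b)
    (hgw : HasL2WeakDerivOn g V a' b') (hb : ∀ᵐ z, z ∈ V → b z = μ z * a z)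
    (hb' : ∀ᵐ z, z ∈ V → b' z = μ z * a' z) (hμ : ∀ᵐ z, z ∈ V → ‖μ z‖ < 1)
    {z₀ : ℂ} (hz₀ : z₀ ∈ V) : DifferentiableAt ℂ h (f z₀) := by
  obtain ⟨R₂, hR₂, hcl⟩ := Metric.nhds_basis_closedBall.mem_iff.1 (hV.mem_nhds hz₀)
  obtain ⟨R, hR, rfl⟩ : ∃ R, 0 < R ∧ 2 * R = R₂ := ⟨R₂ / 2, by positivity, by ring⟩
  set K := Metric.closedBall z₀ R with hK
  have hKc : IsCompact K := isCompact_closedBall _ _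
  have hKm : MeasurableSet K := hKc.measurableSet
  have hKV : K ⊆ V := (Metric.closedBall_subset_closedBall (by linarith)).trans hcl
  have hBK : Metric.ball z₀ (R / 2) ⊆ K :=
    (Metric.ball_subset_ball (by linarith)).trans Metric.ball_subset_closedBall
  have hOf := hopen _ (hBK.trans hKV) Metric.isOpen_ball
  obtain ⟨ρ₂, hρ₂, hcl2⟩ := Metric.nhds_basis_closedBall.mem_iff.1
    (hOf.mem_nhds (mem_image_of_mem f (Metric.mem_ball_self (by positivity : 0 < R / 2))))
  obtain ⟨ρ, hρ, rfl⟩ : ∃ ρ, 0 < ρ ∧ 2 * ρ = ρ₂ := ⟨ρ₂ / 2, by positivity, by ring⟩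
  set S := Metric.closedBall (f z₀) (2 * ρ) with hSdef
  have hSV : S ⊆ f '' V := hcl2.trans (image_mono (hBK.trans hKV))
  have hS : ∀ z ∈ V, f z ∈ S → z ∈ Metric.ball z₀ (R / 2) := by
    intro z hz hzS
    obtain ⟨z', hz', e⟩ := hcl2 hzS
    rwa [← hinj (hKV (hBK hz')) hz e]
  obtain ⟨ha2, hb2⟩ := hfw.1 K hKc hKV
  let J : ℂ → ℝ := fun z => ‖a z‖ ^ 2 - ‖b z‖ ^ 2
  have hJc : ∀ z, a z * conj (a z) - b z * conj (b z) = (J z : ℂ) := by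
    intro z
    simp [J, Complex.mul_conj, Complex.normSq_eq_norm_sq]
  have hJi : Integrable J (volume.restrict K) := by
    exact ha2.integrable_norm_pow (by norm_num) |>.sub (hb2.integrable_norm_pow (by norm_num))
  have hJci : Integrable (fun z => (J z : ℂ)) (volume.restrict K) := hJi.ofReal
  have hfm : AEStronglyMeasurable f (volume.restrict K) :=
    (hf.mono hKV).aestronglyMeasurable hKm
  have hgm : AEStronglyMeasurable g (volume.restrict K) :=
    (hg.mono hKV).aestronglyMeasurable hKm
  obtain ⟨Cg, hCg⟩ := hKc.exists_bound_of_continuousOn (hg.mono hKV)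
  have hgJi : Integrable (fun z => g z * (J z : ℂ)) (volume.restrict K) :=
    hJci.bdd_mul hgm (c := Cg) ((ae_restrict_mem hKm).mono fun z hz => hCg z hz)
  have hJpos : ∀ᵐ z ∂(volume.restrict K), 0 ≤ J z ∧ (J z = 0 → a z = 0 ∧ b z = 0) := by
    filter_upwards [ae_restrict_mem hKm, ae_restrict_of_ae hb, ae_restrict_of_ae hμ]
      with z hz h1 h2
    exact jacobian_nonneg (h1 (hKV hz)) (h2 (hKV hz))
  let χ := bumpSeq ρ hρ
  have hχs : ∀ n, ContDiff ℝ ∞ fun w => ((χ n w : ℝ) : ℂ) := fun n =>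
    Complex.ofRealCLM.contDiff.comp (χ n).contDiff
  have hχc : ∀ n, HasCompactSupport fun w => ((χ n w : ℝ) : ℂ) := fun n =>
    (χ n).hasCompactSupport.comp_left (g := fun x : ℝ => (x : ℂ)) rfl
  let H : ℕ → ℂ → ℂ := fun n t => ∫ z in K, g z * (J z : ℂ) * ((χ n (f z - t) : ℝ) : ℂ)
  let N : ℕ → ℂ → ℂ := fun n t => ∫ z in K, (J z : ℂ) * ((χ n (f z - t) : ℝ) : ℂ)
  have hvan : ∀ {G A' B' : ℂ → ℂ}, ContinuousOn G V → HasL2WeakDerivOn G V A' B' →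
      (∀ᵐ z, z ∈ V → B' z = μ z * A' z) → ∀ n, ∀ t ∈ Metric.ball (f z₀) ρ,
      ∫ z in K, G z * (J z : ℂ) * dzbar (fun w => ((χ n w : ℝ) : ℂ)) (f z - t) = 0 := by
    intro G A' B' hG hGw hB n t ht
    have hη : ContDiff ℝ ∞ (fun w => ((χ n (w - t) : ℝ) : ℂ)) :=
      (hχs n).comp (contDiff_id.sub contDiff_const)
    have hηS := tsupport_translate_subset (bumpSeq_rOut_lt hρ n) ht
    have := integral_mul_dzbar_comp_eq_zero hf hG hfw hGw hb hB hR hcl hS hη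
      (HasCompactSupport.of_support_subset_isCompact (isCompact_closedBall _ _)
        (subset_closure.trans hηS)) hηS
    refine Eq.trans (integral_congr_ae (ae_of_all _ fun z => ?_)) this
    simp only [hJc, dzbar]
    rw [fderiv_comp_sub_const (fun w => ((χ n w : ℝ) : ℂ))]
  have hHd : ∀ n, ∀ t ∈ Metric.ball (f z₀) ρ, DifferentiableAt ℂ (H n) t := fun n t ht =>
    differentiableAt_integral_kernel hgJi hfm (hχs n) (hχc n) t (hvan hg hgw hb' n t ht)
  have hNd : ∀ n, ∀ t ∈ Metric.ball (f z₀) ρ, DifferentiableAt ℂ (N n) t := fun n t ht =>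
    differentiableAt_integral_kernel hJci hfm (hχs n) (hχc n) t (by
      simpa using hvan continuousOn_const (hasL2WeakDerivOn_one V) (by simp) n t ht)
  let Nr : ℕ → ℂ → ℝ := fun n t => ∫ z in K, J z * χ n (f z - t)
  have hNr : ∀ n t, N n t = (Nr n t : ℂ) := by
    intro n t
    simp only [N, Nr, ← Complex.ofReal_mul]
    exact integral_ofReal
  have hχm : ∀ n t, AEStronglyMeasurable (fun z => χ n (f z - t)) (volume.restrict K) :=
    fun n t => (χ n).continuous.comp_aestronglyMeasurable (hfm.sub aestronglyMeasurable_const)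
  have hNri : ∀ n t, Integrable (fun z => J z * χ n (f z - t)) (volume.restrict K) := by
    intro n t
    refine hJi.mul_bdd (c := 1) (hχm n t) (ae_of_all _ fun z => ?_)
    rw [Real.norm_of_nonneg (χ n).nonneg]
    exact (χ n).le_one
  have hNpos : ∀ n, ∀ t ∈ Metric.ball (f z₀) ρ, 0 < Nr n t := by
    intro n t ht
    have h0 : 0 ≤ᵐ[volume.restrict K] fun z => J z * χ n (f z - t) := by
      filter_upwards [hJpos] with z hz using mul_nonneg hz.1 (χ n).nonneg
    refine lt_of_le_of_ne (integral_nonneg_of_ae h0) fun heq => ?_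
    have hz := (integral_eq_zero_iff_of_nonneg_ae h0 (hNri n t)).1 heq.symm
    obtain ⟨z₁, hz₁, rfl⟩ := hcl2 (Metric.closedBall_subset_closedBall (by linarith)
      (Metric.ball_subset_closedBall ht))
    have hOo : IsOpen (V ∩ f ⁻¹' Metric.ball (f z₁) (χ n).rOut) :=
      hf.isOpen_inter_preimage hV Metric.isOpen_ball
    have hmem : z₁ ∈ (V ∩ f ⁻¹' Metric.ball (f z₁) (χ n).rOut) ∩ Metric.ball z₀ (R / 2) :=
      ⟨⟨hKV (hBK hz₁), Metric.mem_ball_self (χ n).rOut_pos⟩, hz₁⟩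
    obtain ⟨s₂, hs₂, hs⟩ := Metric.nhds_basis_closedBall.mem_iff.1
      ((hOo.inter Metric.isOpen_ball).mem_nhds hmem)
    obtain ⟨s, hs0, rfl⟩ : ∃ s, 0 < s ∧ 2 * s = s₂ := ⟨s₂ / 2, by positivity, by ring⟩
    have hab : ∀ᵐ z, z ∈ Metric.closedBall z₁ (2 * s) → a z = 0 ∧ b z = 0 := by
      have h1 := (ae_restrict_iff' hKm).1 hz
      have h2 := (ae_restrict_iff' hKm).1 hJpos
      filter_upwards [h1, h2] with z e1 e2 hzs
      have hzK := hBK (hs hzs).2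
      have hzb : dist (f z) (f z₁) < (χ n).rOut := (hs hzs).1.2
      have : 0 < χ n (f z - f z₁) :=
        (χ n).pos_of_mem_ball (by rwa [mem_ball_zero_iff, ← dist_eq_norm])
      have e3 : J z * χ n (f z - f z₁) = 0 := e1 hzK
      exact (e2 hzK).2 ((mul_eq_zero.1 e3).resolve_right this.ne')
    have hc := constant_of_weakDeriv_zero hf hfw hs0 (fun z hz => (hs hz).1.1)
      (hab.mono fun z h hz => (h hz).1) (hab.mono fun z h hz => (h hz).2)
    have hp : z₁ + (s / 2 : ℝ) ∈ Metric.ball z₁ s := by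
      rw [Metric.mem_ball, dist_eq_norm, add_sub_cancel_left, Complex.norm_real,
        Real.norm_of_nonneg (by positivity)]
      linarith
    have hpV : z₁ + (s / 2 : ℝ) ∈ V :=
      (hs (Metric.closedBall_subset_closedBall (by linarith) (Metric.ball_subset_closedBall hp))).1.1
    have := hinj hpV (hKV (hBK hz₁)) (hc _ hp)
    have h3 : ((s / 2 : ℝ) : ℂ) = 0 := by simpa using this
    have h4 : s / 2 = 0 := by exact_mod_cast h3
    linarith
  have hlim : TendstoUniformlyOn (fun n t => H n t / N n t) h atTop (Metric.ball (f z₀) ρ) := by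
    have hu := (isCompact_closedBall (f z₀) (2 * ρ)).uniformContinuousOn_of_continuous
      (hh.mono hSV)
    rw [Metric.uniformContinuousOn_iff_le] at hu
    rw [Metric.tendstoUniformlyOn_iff]
    intro ε hε
    obtain ⟨δ, hδ, hu⟩ := hu (ε / 2) (by positivity)
    filter_upwards [(tendsto_bumpSeq_rOut hρ).eventually (gt_mem_nhds hδ)] with n hn t ht
    have hNp := hNpos n t ht
    have htS : t ∈ S := Metric.closedBall_subset_closedBall (by linarith)
      (Metric.ball_subset_closedBall ht)
    have e1 : H n t - h t * N n t =
        ∫ z in K, (g z - h t) * ((J z * χ n (f z - t) : ℝ) : ℂ) := by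
      simp only [H, N]
      rw [← integral_const_mul, ← integral_sub]
      · refine integral_congr_ae (ae_of_all _ fun z => ?_)
        simp only; push_cast; ring
      · have := (hNri n t).ofReal (𝕜 := ℂ)
        refine (this.bdd_mul hgm (c := Cg) ((ae_restrict_mem hKm).mono fun z hz => hCg z hz)).congr
          (ae_of_all _ fun z => ?_)
        simp; ring
      · have := (hNri n t).ofReal (𝕜 := ℂ)
        refine (this.const_mul (h t)).congr (ae_of_all _ fun z => ?_)
        simp
    have e2 : ‖H n t - h t * N n t‖ ≤ ε / 2 * Nr n t := by
      rw [e1]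
      simp only [Nr]
      rw [← integral_const_mul]
      refine norm_integral_le_of_norm_le ((hNri n t).const_mul _) ?_
      filter_upwards [hJpos, ae_restrict_mem hKm] with z hz hzK
      rw [norm_mul, Complex.norm_real, Real.norm_of_nonneg (mul_nonneg hz.1 (χ n).nonneg)]
      by_cases hc : χ n (f z - t) = 0
      · simp [hc]
      · refine mul_le_mul_of_nonneg_right ?_ (mul_nonneg hz.1 (χ n).nonneg)
        have hm : f z - t ∈ Function.support (χ n) := hc
        rw [(χ n).support_eq, mem_ball_zero_iff, ← dist_eq_norm] at hm
        have hlt := bumpSeq_rOut_lt hρ n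
        have hfS : f z ∈ S := by
          rw [Metric.mem_ball] at ht
          rw [Metric.mem_closedBall]
          have : dist (f z) t < ρ := hm.trans hlt
          linarith [dist_triangle (f z) t (f z₀)]
        rw [← hhf z (hKV hzK), ← dist_eq_norm]
        exact hu _ hfS _ htS (hm.trans hn).le
    have hN0 : N n t ≠ 0 := by rw [hNr]; exact_mod_cast hNp.ne'
    rw [dist_comm, dist_eq_norm, div_sub' hN0, norm_div, mul_comm (N n t)]
    have : ‖N n t‖ = Nr n t := by rw [hNr, Complex.norm_real, Real.norm_of_nonneg hNp.le]
    rw [this, div_lt_iff₀ hNp]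
    nlinarith
  have := hlim.tendstoLocallyUniformlyOn.differentiableOn (Eventually.of_forall fun n t ht =>
    ((hHd n t ht).div (hNd n t ht) (by
      rw [hNr]; exact_mod_cast (hNpos n t ht).ne')).differentiableWithinAt) Metric.isOpen_ball
  exact this.differentiableAt (Metric.ball_mem_nhds _ hρ)

end NodedQC

namespace NodedQC

@[simp] lemma toC_coe (z : ℂ) : toC (z : Sphere) = z := rfl

lemma coe_toC {p : Sphere} (hp : p ≠ OnePoint.infty) : (toC p : Sphere) = p := by
  obtain ⟨z, rfl⟩ := OnePoint.ne_infty_iff_exists.1 hp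
  rfl

lemma continuousOn_toC : ContinuousOn toC {OnePoint.infty}ᶜ := by
  intro p hp
  obtain ⟨z, rfl⟩ := OnePoint.ne_infty_iff_exists.1 hp
  refine ContinuousAt.continuousWithinAt ?_
  rw [OnePoint.continuousAt_coe]
  exact continuousAt_id

@[simp] lemma inversion_infty : inversion OnePoint.infty = ((0 : ℂ) : Sphere) := rfl

@[simp] lemma inversion_zero : inversion ((0 : ℂ) : Sphere) = OnePoint.infty := by
  simp [inversion]

lemma inversion_coe {z : ℂ} (hz : z ≠ 0) : inversion (z : Sphere) = ((z⁻¹ : ℂ) : Sphere) := by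
  simp [inversion, hz]

lemma inversion_inversion (p : Sphere) : inversion (inversion p) = p := by
  induction p using OnePoint.rec with
  | infty => simp
  | coe z =>
    by_cases hz : z = 0
    · simp [hz]
    · rw [inversion_coe hz, inversion_coe (inv_ne_zero hz), inv_inv]

lemma continuous_inversion : Continuous inversion := by
  have hev : ∀ z : ℂ, z ≠ 0 → ∀ᶠ x in 𝓝 z, ((x⁻¹ : ℂ) : Sphere) = inversion (x : Sphere) := by
    intro z hz
    filter_upwards [isOpen_ne.mem_nhds hz] with x hx using (inversion_coe hx).symm
  rw [OnePoint.continuous_iff]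
  constructor
  · have h1 : Tendsto (fun z : ℂ => ((z⁻¹ : ℂ) : Sphere)) (coclosedCompact ℂ)
        (𝓝 ((0 : ℂ) : Sphere)) := by
      rw [coclosedCompact_eq_cocompact]
      exact (OnePoint.continuous_coe.tendsto _).comp
        (Metric.cobounded_eq_cocompact (α := ℂ) ▸
          tendsto_inv₀_cobounded'.mono_right nhdsWithin_le_nhds)
    refine h1.congr' ?_
    rw [coclosedCompact_eq_cocompact]
    filter_upwards [(isCompact_singleton (x := (0 : ℂ))).compl_mem_cocompact] with x hx
    exact (inversion_coe hx).symm
  · rw [continuous_iff_continuousAt]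
    intro z
    by_cases hz : z = 0
    · subst hz
      rw [continuousAt_iff_punctured_nhds, inversion_zero]
      have h1 : Tendsto (fun z : ℂ => ((z⁻¹ : ℂ) : Sphere)) (𝓝[≠] 0) (𝓝 OnePoint.infty) := by
        refine OnePoint.tendsto_coe_infty.comp ?_
        rw [coclosedCompact_eq_cocompact, ← Metric.cobounded_eq_cocompact]
        exact tendsto_inv₀_nhdsNE_zero
      refine h1.congr' ?_
      filter_upwards [self_mem_nhdsWithin] with x hx using (inversion_coe hx).symm
    · have : ContinuousAt (fun x : ℂ => ((x⁻¹ : ℂ) : Sphere)) z :=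
        OnePoint.continuous_coe.continuousAt.comp (continuousAt_inv₀ hz)
      exact this.congr (hev z hz)

lemma coord_coord (i : Bool) (p : Sphere) : coord i (coord i p) = p := by
  cases i
  · rfl
  · exact inversion_inversion p

lemma continuous_coord (i : Bool) : Continuous (coord i) := by
  cases i
  · exact continuous_id
  · exact continuous_inversion

lemma coord_injective (i : Bool) : Function.Injective (coord i) :=
  Function.Involutive.injective (coord_coord i)

lemma exists_coord_ne_infty (p : Sphere) : ∃ j, coord j p ≠ OnePoint.infty := by
  by_cases hp : p = OnePoint.infty
  · exact ⟨true, by simp [hp, coord]⟩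
  · exact ⟨false, hp⟩

/-! ### Winding -/

/-- `γ` has a continuous logarithm that increases by `c` along `[0, 2π]`. -/
def LogIncrement (γ : ℝ → ℂ) (c : ℂ) : Prop :=
  ∃ L : ℝ → ℂ, Continuous L ∧ (∀ t : ℝ, Complex.exp (L t) = γ t) ∧ L (2 * Real.pi) = L 0 + c

lemma eq_of_exp_eq {X : Type*} [TopologicalSpace X] [PreconnectedSpace X] {L M : X → ℂ}
    (hL : Continuous L) (hM : Continuous M) (h : ∀ x, Complex.exp (L x) = Complex.exp (M x))
    {x₀ : X} (h₀ : L x₀ = M x₀) (x : X) : L x = M x := by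
  refine congrFun (Complex.isCoveringMap_exp.eq_of_comp_eq hL hM ?_ x₀ h₀) x
  ext y
  exact h y

lemma LogIncrement.unique {γ : ℝ → ℂ} {c d : ℂ} (hc : LogIncrement γ c) (hd : LogIncrement γ d) :
    c = d := by
  obtain ⟨L, hL, hLγ, hL2⟩ := hc
  obtain ⟨M, hM, hMγ, hM2⟩ := hd
  have := eq_of_exp_eq hL (M := fun t => M t + (L 0 - M 0)) (by fun_prop) (x₀ := 0)
    (fun t => by
      rw [Complex.exp_add, Complex.exp_sub, hLγ, hMγ, hLγ, hMγ, div_self, mul_one]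
      rw [← hMγ]; exact Complex.exp_ne_zero _) (by ring) (2 * Real.pi)
  rw [hL2, hM2] at this
  linear_combination this

lemma LogIncrement.const {c : ℂ} (hc : c ≠ 0) : LogIncrement (fun _ => c) 0 :=
  ⟨fun _ => Complex.log c, continuous_const, fun _ => Complex.exp_log hc, by simp⟩

lemma LogIncrement.mul {γ δ : ℝ → ℂ} {c d : ℂ} (hc : LogIncrement γ c) (hd : LogIncrement δ d) :
    LogIncrement (fun t => γ t * δ t) (c + d) := by
  obtain ⟨L, hL, hLγ, hL2⟩ := hc
  obtain ⟨M, hM, hMγ, hM2⟩ := hd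
  exact ⟨fun t => L t + M t, hL.add hM, fun t => by rw [Complex.exp_add, hLγ, hMγ], by
    simp only [hL2, hM2]; ring⟩

lemma LogIncrement.div {γ δ : ℝ → ℂ} {c d : ℂ} (hc : LogIncrement γ c) (hd : LogIncrement δ d) :
    LogIncrement (fun t => γ t / δ t) (c - d) := by
  obtain ⟨L, hL, hLγ, hL2⟩ := hc
  obtain ⟨M, hM, hMγ, hM2⟩ := hd
  exact ⟨fun t => L t - M t, hL.sub hM, fun t => by rw [Complex.exp_sub, hLγ, hMγ], by
    simp only [hL2, hM2]; ring⟩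

lemma LogIncrement.of_homotopy {H : ℝ → ℝ → ℂ} {c : ℂ}
    (hH : ContinuousOn (Function.uncurry H) (Icc 0 1 ×ˢ univ))
    (h0 : ∀ τ ∈ Icc (0 : ℝ) 1, ∀ t, H τ t ≠ 0)
    (hper : ∀ τ ∈ Icc (0 : ℝ) 1, H τ (2 * Real.pi) = H τ 0) (h : LogIncrement (H 0) c) :
    LogIncrement (H 1) c := by
  obtain ⟨L, hL, hLγ, hL2⟩ := h
  let κ : ℝ → ℝ := fun τ => max 0 (min 1 τ)
  have hκ : ∀ τ, κ τ ∈ Icc (0 : ℝ) 1 := fun τ =>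
    ⟨le_max_left _ _, max_le zero_le_one (min_le_left _ _)⟩
  have hκc : Continuous κ := by fun_prop
  have hκ0 : κ 0 = 0 := by simp [κ]
  have hκ1 : κ 1 = 1 := by simp [κ]
  have hGc : Continuous fun p : ℝ × ℝ => H (κ p.1) p.2 :=
    hH.comp_continuous (f := fun p : ℝ × ℝ => (κ p.1, p.2)) (by fun_prop)
      fun p => ⟨hκ p.1, mem_univ _⟩
  obtain ⟨M, ⟨hM0, hM⟩, -⟩ := Complex.isCoveringMapOn_exp.existsUnique_continuousMap_lifts
    (⟨fun p : ℝ × ℝ => H (κ p.1) p.2, hGc⟩ : C(ℝ × ℝ, ℂ)) (a₀ := (0, 0)) (e₀ := L 0)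
    (by simp [hLγ, hκ0]) (fun p => h0 _ (hκ p.1) p.2)
  have hMe : ∀ τ t, Complex.exp (M (τ, t)) = H (κ τ) t := fun τ t => congrFun hM (τ, t)
  have hMc : Continuous M := M.continuous
  have e0 : ∀ t, M (0, t) = L t := eq_of_exp_eq (x₀ := (0 : ℝ)) (by fun_prop) hL
    (fun t => by rw [hMe, hκ0, hLγ]) hM0
  have hc : Complex.exp c = 1 := by
    have h1 : Complex.exp (L (2 * Real.pi)) = Complex.exp (L 0) := by
      rw [hLγ, hLγ, hper 0 (by simp)]
    rw [hL2, Complex.exp_add] at h1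
    exact mul_left_cancel₀ (Complex.exp_ne_zero _) (h1.trans (mul_one _).symm)
  have e1 := eq_of_exp_eq (L := fun τ => M (τ, 2 * Real.pi)) (M := fun τ => M (τ, 0) + c)
    (x₀ := (0 : ℝ)) (by fun_prop) (by fun_prop)
    (fun τ => by rw [Complex.exp_add, hMe, hMe, hc, mul_one, hper _ (hκ τ)])
    (by rw [e0, e0, hL2]) 1
  exact ⟨fun t => M (1, t), by fun_prop, fun t => by rw [hMe, hκ1], e1⟩

lemma circleMap_two_pi (z : ℂ) (r : ℝ) : circleMap z r (2 * Real.pi) = circleMap z r 0 := by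
  simp [circleMap]

/-- A nonvanishing function on a disc has no winding along concentric circles. -/
lemma logIncrement_zero_of_ball {k : ℂ → ℂ} {z₀ : ℂ} {r : ℝ} (hr : 0 ≤ r)
    (hk : ContinuousOn k (Metric.closedBall z₀ r)) (h0 : ∀ z ∈ Metric.closedBall z₀ r, k z ≠ 0) :
    LogIncrement (fun t => k (circleMap z₀ r t)) 0 := by
  have hmem : ∀ τ ∈ Icc (0 : ℝ) 1, ∀ t, circleMap z₀ (τ * r) t ∈ Metric.closedBall z₀ r := by
    intro τ hτ t
    refine Metric.closedBall_subset_closedBall (ε₁ := τ * r) (by nlinarith [hτ.1, hτ.2])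
      (circleMap_mem_closedBall _ (mul_nonneg hτ.1 hr) _)
  have := LogIncrement.of_homotopy (H := fun τ t => k (circleMap z₀ (τ * r) t)) (c := 0)
    (hk.comp (Continuous.continuousOn (by unfold circleMap; fun_prop))
      fun p hp => hmem p.1 hp.1 p.2)
    (fun τ hτ t => h0 _ (hmem τ hτ t)) (fun τ _ => by simp only [circleMap_two_pi])
    (by simpa using LogIncrement.const (h0 z₀ (Metric.mem_closedBall_self hr)))
  simpa using this

lemma hasLocalDegreeOne_of_deriv_ne_zero {F : ℂ → ℂ} {z₀ : ℂ} {R : ℝ} (hR : 0 < R)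
    (hF : DifferentiableOn ℂ F (Metric.ball z₀ R)) (hd : deriv F z₀ ≠ 0) :
    HasLocalDegreeOne F z₀ := by
  have hk : ContinuousOn (dslope F z₀) (Metric.ball z₀ R) :=
    (continuousOn_dslope (Metric.ball_mem_nhds _ hR)).2
      ⟨hF.continuousOn, hF.differentiableAt (Metric.ball_mem_nhds _ hR)⟩
  have hk0 : dslope F z₀ z₀ ≠ 0 := by rwa [dslope_same]
  obtain ⟨R', hR', hb⟩ := Metric.mem_nhds_iff.1
    ((hk.continuousAt (Metric.ball_mem_nhds _ hR)).eventually_ne hk0)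
  refine ⟨min R R', lt_min hR hR', fun r hr hrR => ?_⟩
  have h1 := logIncrement_zero_of_ball hr.le
    (hk.mono (Metric.closedBall_subset_ball (hrR.trans_le (min_le_left _ _))))
    fun z hz => hb (Metric.closedBall_subset_ball (hrR.trans_le (min_le_right _ _)) hz)
  have h2 : LogIncrement (fun t => circleMap z₀ r t - z₀) (2 * Real.pi * Complex.I) := by
    refine ⟨fun t => Real.log r + t * Complex.I, by fun_prop, fun t => ?_, by push_cast; ring⟩
    rw [Complex.exp_add, ← Complex.ofReal_exp, Real.exp_log hr]
    simp [circleMap]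
  have h3 := h2.mul h1
  rw [add_zero] at h3
  obtain ⟨L, hL, hLe, hL2⟩ := h3
  refine ⟨L, hL, fun t => ?_, hL2⟩
  rw [hLe]
  exact sub_smul_dslope F z₀ _

lemma HasLocalDegreeOne.transfer {F : ℂ → ℂ} {z₀ z₁ : ℂ} {R : ℝ}
    (hF : ContinuousOn F (Metric.ball z₀ R)) (hinj : InjOn F (Metric.ball z₀ R))
    (hz₁ : z₁ ∈ Metric.ball z₀ R) (h : HasLocalDegreeOne F z₁) : HasLocalDegreeOne F z₀ := by
  obtain ⟨R₁, hR₁, h⟩ := h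
  rw [Metric.mem_ball] at hz₁
  refine ⟨R, dist_nonneg.trans_lt hz₁, fun r hr hrR => ?_⟩
  set s := min R₁ (R - dist z₁ z₀) / 2 with hs
  have hm : 0 < min R₁ (R - dist z₁ z₀) := lt_min hR₁ (sub_pos.2 hz₁)
  have hs0 : 0 < s := by positivity
  have hs1 : s < R₁ := by linarith [min_le_left R₁ (R - dist z₁ z₀)]
  have hs2 : s < R - dist z₁ z₀ := by linarith [min_le_right R₁ (R - dist z₁ z₀)]
  let c : ℝ → ℂ := fun τ => z₁ + τ * (z₀ - z₁)
  let ρ : ℝ → ℝ := fun τ => s + τ * (r - s)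
  have hρ : ∀ τ ∈ Icc (0 : ℝ) 1, 0 < ρ τ := by
    intro τ hτ
    have e : ρ τ = (1 - τ) * s + τ * r := by simp only [ρ]; ring
    rw [e]
    rcases hτ.2.lt_or_eq with h1 | h1
    · have := mul_pos (sub_pos.2 h1) hs0
      have := mul_nonneg hτ.1 hr.le
      linarith
    · simp [h1, hr]
  have hcd : ∀ τ ∈ Icc (0 : ℝ) 1, dist (c τ) z₀ + ρ τ < R := by
    intro τ hτ
    have e : dist (c τ) z₀ = (1 - τ) * dist z₁ z₀ := by
      rw [dist_eq_norm, dist_eq_norm, show c τ - z₀ = ((1 - τ : ℝ) : ℂ) * (z₁ - z₀) by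
        simp only [c]; push_cast; ring, norm_mul, Complex.norm_real,
        Real.norm_of_nonneg (sub_nonneg.2 hτ.2)]
    rw [e]
    simp only [ρ]
    rcases hτ.1.lt_or_eq with h1 | h1
    · nlinarith [mul_pos h1 (sub_pos.2 hrR), mul_nonneg (sub_nonneg.2 hτ.2) (sub_pos.2 hs2).le]
    · rw [← h1]; linarith
  have hcmem : ∀ τ ∈ Icc (0 : ℝ) 1, c τ ∈ Metric.ball z₀ R := fun τ hτ => by
    rw [Metric.mem_ball]; linarith [hcd τ hτ, hρ τ hτ]
  have hmem : ∀ τ ∈ Icc (0 : ℝ) 1, ∀ t, circleMap (c τ) (ρ τ) t ∈ Metric.ball z₀ R := by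
    intro τ hτ t
    have h1 := circleMap_mem_closedBall (c τ) (hρ τ hτ).le t
    rw [Metric.mem_closedBall] at h1
    rw [Metric.mem_ball]
    linarith [hcd τ hτ, dist_triangle (circleMap (c τ) (ρ τ) t) (c τ) z₀]
  have := LogIncrement.of_homotopy
    (H := fun τ t => F (circleMap (c τ) (ρ τ) t) - F (c τ)) (c := 2 * Real.pi * Complex.I)
    (ContinuousOn.sub
      (hF.comp (Continuous.continuousOn (by
        unfold circleMap; simp only [c, ρ]; fun_prop)) fun p hp => hmem p.1 hp.1 p.2)
      (hF.comp (f := fun p : ℝ × ℝ => c p.1) (Continuous.continuousOn (by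
        simp only [c]; fun_prop)) fun p hp => hcmem p.1 hp.1))
    (fun τ hτ t => sub_ne_zero.2 fun he =>
      circleMap_ne_center (hρ τ hτ).ne' (hinj (hmem τ hτ t) (hcmem τ hτ) he))
    (fun τ _ => by simp only [circleMap_two_pi])
    (by simpa [c, ρ] using! h s hs0 hs1)
  simpa [c, ρ] using! this

/-- A continuous self-map of the sphere with a simple value of local degree one is onto. -/
lemma surjective_of_hasLocalDegreeOne {w : Sphere → Sphere} (hw : Continuous w) {z₀ : ℂ}
    (hz₀ : w z₀ ≠ OnePoint.infty) (hfib : ∀ p, w p = w z₀ → p = z₀)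
    (hdeg : HasLocalDegreeOne (rep w false false) z₀) : Function.Surjective w := by
  by_contra hns
  have hcl : IsClosed (range w) := (isCompact_range hw).isClosed
  have hne : ((range w)ᶜ).Nonempty := by
    rw [nonempty_compl]
    exact fun h => hns (range_eq_univ.1 h)
  obtain ⟨_, hb, b, rfl⟩ := (OnePoint.denseRange_coe (X := ℂ)).inter_open_nonempty _
    hcl.isOpen_compl hne
  have hb' : ∀ p, w p ≠ (b : Sphere) := fun p h => hb ⟨p, h⟩
  let F : ℂ → ℂ := rep w false false
  have hFw : ∀ z : ℂ, w z ≠ OnePoint.infty → (F z : Sphere) = w z := fun z hz => coe_toC hz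
  let κ : Sphere → ℂ := fun q => toC (inversion (OnePoint.map (fun z => z - b) q))
  have hκ : ∀ q, q ≠ (b : Sphere) → ContinuousAt κ q := by
    intro q hq
    have h1 : Continuous fun q : Sphere => inversion (OnePoint.map (fun z => z - b) q) :=
      continuous_inversion.comp
        (OnePoint.continuous_map (by fun_prop) (by
          rw [coclosedCompact_eq_cocompact]
          exact (Homeomorph.subRight b).isClosedEmbedding.tendsto_cocompact))
    have h2 : inversion (OnePoint.map (fun z => z - b) q) ≠ OnePoint.infty := by
      induction q using OnePoint.rec with
      | infty => simp
      | coe z =>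
        have : z - b ≠ 0 := fun h => hq (by rw [sub_eq_zero.1 h])
        rw [OnePoint.map_some, inversion_coe this]
        exact OnePoint.coe_ne_infty _
    exact ContinuousAt.comp
      (f := fun q : Sphere => inversion (OnePoint.map (fun z => z - b) q))
      (continuousOn_toC.continuousAt (OnePoint.isClosed_infty.isOpen_compl.mem_nhds h2))
      h1.continuousAt
  have hκc : ∀ z : ℂ, z ≠ b → κ z = (z - b)⁻¹ := by
    intro z hz
    simp only [κ, OnePoint.map_some]
    rw [inversion_coe (sub_ne_zero.2 hz), toC_coe]
  have hκi : κ OnePoint.infty = 0 := by simp [κ]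
  let u : Sphere → ℂ := fun p => 1 + (b - F z₀) * κ (w p)
  have huc : Continuous u := continuous_const.add (continuous_const.mul
    (continuous_iff_continuousAt.2 fun p => (hκ _ (hb' p)).comp hw.continuousAt))
  have huf : ∀ p (z : ℂ), w p = z → u p = (z - F z₀) / (z - b) := by
    intro p z hz
    have hzb : z ≠ b := fun h => hb' p (by rw [hz, h])
    have := sub_ne_zero.2 hzb
    simp only [u]
    rw [hz, hκc z hzb]
    field_simp
    ring
  have hu0 : ∀ p, p ≠ (z₀ : Sphere) → u p ≠ 0 := by
    intro p hp
    by_cases hi : w p = OnePoint.infty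
    · simp [u, hi, hκi]
    · obtain ⟨z, hz⟩ := OnePoint.ne_infty_iff_exists.1 hi
      have hzb : z ≠ b := fun h => hb' p (by rw [← hz, h])
      rw [huf p z hz.symm]
      refine div_ne_zero (sub_ne_zero.2 fun h => hp (hfib p ?_)) (sub_ne_zero.2 hzb)
      rw [← hz, h, hFw z₀ hz₀]
  obtain ⟨R, hR, hdeg⟩ := hdeg
  have hfin : ∀ᶠ z : ℂ in 𝓝 z₀, w z ≠ OnePoint.infty :=
    (hw.comp OnePoint.continuous_coe).continuousAt.eventually_ne hz₀
  obtain ⟨R', hR', hfin⟩ := Metric.mem_nhds_iff.1 hfin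
  obtain ⟨r, hr, hrR⟩ := exists_between (lt_min hR hR')
  have hcb : ∀ z ∈ Metric.closedBall z₀ r, w z ≠ OnePoint.infty := fun z hz =>
    hfin (Metric.closedBall_subset_ball (hrR.trans_le (min_le_right _ _)) hz)
  have hFc : ContinuousOn F (Metric.closedBall z₀ r) :=
    continuousOn_toC.comp (hw.comp OnePoint.continuous_coe).continuousOn fun z hz => hcb z hz
  have h1 : LogIncrement (fun t => F (circleMap z₀ r t) - F z₀) (2 * Real.pi * Complex.I) :=
    hdeg r hr (hrR.trans_le (min_le_left _ _))
  have h2 : LogIncrement (fun t => F (circleMap z₀ r t) - b) 0 :=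
    logIncrement_zero_of_ball (k := fun z => F z - b) hr.le (hFc.sub continuousOn_const)
      fun z hz => sub_ne_zero.2 fun h => hb' z (by rw [← hFw z (hcb z hz), h])
  have h3 : LogIncrement (fun t => u (circleMap z₀ r t)) (2 * Real.pi * Complex.I) := by
    have := h1.div h2
    rw [sub_zero] at this
    convert this using 2 with t
    exact huf _ _ (hFw _ (hcb _ (circleMap_mem_closedBall _ hr.le _))).symm
  let x : ℝ → ℝ → Sphere := fun τ t => OnePoint.map (fun z => z + z₀)
    (inversion ((τ * ((r : ℂ)⁻¹ * Complex.exp (-(t * Complex.I))) : ℂ) : Sphere))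
  have hmap : Continuous (OnePoint.map fun z : ℂ => z + z₀) :=
    OnePoint.continuous_map (by fun_prop) (by
      rw [coclosedCompact_eq_cocompact]
      exact (Homeomorph.addRight z₀).isClosedEmbedding.tendsto_cocompact)
  have hx : Continuous (Function.uncurry x) := by
    refine hmap.comp (continuous_inversion.comp (OnePoint.continuous_coe.comp ?_))
    fun_prop
  have hx0 : ∀ t, x 0 t = OnePoint.infty := by simp [x]
  have hrC : (r : ℂ) ≠ 0 := by exact_mod_cast hr.ne'
  have hx1 : ∀ t, x 1 t = (circleMap z₀ r t : ℂ) := by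
    intro t
    simp only [x]
    rw [inversion_coe (by simp [hrC, Complex.exp_ne_zero]), OnePoint.map_some, circleMap]
    congr 1
    rw [Complex.ofReal_one, one_mul, mul_inv, inv_inv, ← Complex.exp_neg, neg_neg, add_comm]
  have hxz : ∀ τ t, x τ t ≠ (z₀ : Sphere) := by
    intro τ t h
    simp only [x] at h
    by_cases hq : (τ * ((r : ℂ)⁻¹ * Complex.exp (-(t * Complex.I))) : ℂ) = 0
    · rw [hq, inversion_zero, OnePoint.map_infty] at h
      exact OnePoint.infty_ne_coe _ h
    · rw [inversion_coe hq, OnePoint.map_some, OnePoint.coe_eq_coe, add_eq_right] at h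
      exact inv_ne_zero hq h
  have h4 : LogIncrement (fun t => u (x 1 t)) 0 := by
    refine LogIncrement.of_homotopy (H := fun τ t => u (x τ t)) (huc.comp hx).continuousOn
      (fun τ _ t => hu0 _ (hxz τ t)) (fun τ _ => ?_) ?_
    · have : Complex.exp (-(((2 * Real.pi : ℝ) : ℂ) * Complex.I)) = 1 := by
        rw [Complex.exp_neg]; simp
      simp only [x]
      rw [this]; simp
    · simp only [hx0]
      refine LogIncrement.const (hu0 _ (OnePoint.infty_ne_coe _))
  simp only [hx1] at h4
  have := h3.unique h4
  simp [Real.pi_ne_zero] at this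

end NodedQC

namespace NodedQC

/-! ### The spherical metric -/

lemma continuous_toUnitSphere : Continuous toUnitSphere := by
  have hsq : Tendsto (fun z : ℂ => ‖z‖ ^ 2 + 1) (cocompact ℂ) atTop :=
    tendsto_atTop_add_const_right _ _
      ((tendsto_pow_atTop two_ne_zero).comp (tendsto_norm_cocompact_atTop (E := ℂ)))
  have hinv : Tendsto (fun z : ℂ => ‖z‖⁻¹) (cocompact ℂ) (𝓝 0) :=
    tendsto_inv_atTop_zero.comp (tendsto_norm_cocompact_atTop (E := ℂ))
  have hsmall : ∀ {k : ℂ → ℝ}, (∀ z, |k z| ≤ ‖z‖) →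
      Tendsto (fun z => 2 * k z / (‖z‖ ^ 2 + 1)) (cocompact ℂ) (𝓝 0) := by
    intro k hk
    have h2 : Tendsto (fun z : ℂ => 2 * ‖z‖⁻¹) (cocompact ℂ) (𝓝 0) := by
      simpa using hinv.const_mul 2
    refine squeeze_zero_norm (fun z => ?_) h2
    rw [Real.norm_eq_abs, abs_div, abs_mul, abs_two, abs_of_pos (by positivity : 0 < ‖z‖ ^ 2 + 1),
      div_le_iff₀ (by positivity)]
    rcases (norm_nonneg z).eq_or_lt with h | h
    · have := hk z
      rw [← h] at this ⊢
      simp [abs_nonpos_iff.1 this]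
    · have e : 2 * ‖z‖⁻¹ * (‖z‖ ^ 2 + 1) = 2 * ‖z‖ + 2 * ‖z‖⁻¹ := by field_simp
      have := hk z
      have : 0 < ‖z‖⁻¹ := inv_pos.2 h
      linarith
  have h3 : Tendsto (fun z : ℂ => (‖z‖ ^ 2 - 1) / (‖z‖ ^ 2 + 1)) (cocompact ℂ) (𝓝 1) := by
    have := (hsq.inv_tendsto_atTop.const_mul 2).const_sub 1
    rw [mul_zero, sub_zero] at this
    refine this.congr fun z => ?_
    have : ‖z‖ ^ 2 + 1 ≠ 0 := by positivity
    simp only [Pi.inv_apply]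
    field_simp
    ring
  rw [OnePoint.continuous_iff, coclosedCompact_eq_cocompact]
  constructor
  · have := (PiLp.continuous_toLp 2 (fun _ : Fin 3 => ℝ)).tendsto ![(0 : ℝ), 0, 1]
    refine this.comp (tendsto_pi_nhds.2 fun i => ?_)
    fin_cases i
    · exact hsmall Complex.abs_re_le_norm
    · exact hsmall Complex.abs_im_le_norm
    · exact h3
  · have hne : ∀ z : ℂ, ‖z‖ ^ 2 + 1 ≠ 0 := fun z => by positivity
    refine (PiLp.continuous_toLp 2 (fun _ : Fin 3 => ℝ)).comp (continuous_pi fun i => ?_)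
    fin_cases i
    · exact (continuous_const.mul Complex.continuous_re).div (by fun_prop) hne
    · exact (continuous_const.mul Complex.continuous_im).div (by fun_prop) hne
    · exact Continuous.div (by fun_prop) (by fun_prop) hne

lemma toUnitSphere_injective : Function.Injective toUnitSphere := by
  have key : ∀ z : ℂ, (‖z‖ ^ 2 - 1) / (‖z‖ ^ 2 + 1) = 1 - 2 * (‖z‖ ^ 2 + 1)⁻¹ := by
    intro z
    have : ‖z‖ ^ 2 + 1 ≠ 0 := by positivity
    field_simp
    ring
  have hpos : ∀ z : ℂ, 0 < (‖z‖ ^ 2 + 1)⁻¹ := fun z => by positivity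
  intro p q h
  have h0 := congrFun (congrArg WithLp.ofLp h) 0
  have h1 := congrFun (congrArg WithLp.ofLp h) 1
  have h2 := congrFun (congrArg WithLp.ofLp h) 2
  induction p using OnePoint.rec with
  | infty =>
    induction q using OnePoint.rec with
    | infty => rfl
    | coe z =>
      simp [toUnitSphere] at h2
      have := key z
      have := hpos z
      linarith
  | coe z =>
    induction q using OnePoint.rec with
    | infty =>
      simp [toUnitSphere] at h2
      have := key z
      have := hpos z
      linarith
    | coe z' =>
      simp [toUnitSphere] at h0 h1 h2
      rw [key, key] at h2
      have e : ‖z‖ ^ 2 + 1 = ‖z'‖ ^ 2 + 1 := inv_injective (by linarith)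
      rw [e] at h0 h1
      have hne : ‖z'‖ ^ 2 + 1 ≠ 0 := by positivity
      rw [div_left_inj' hne] at h0 h1
      exact congrArg _ (Complex.ext (by linarith) (by linarith))

lemma isClosedEmbedding_toUnitSphere : IsClosedEmbedding toUnitSphere :=
  continuous_toUnitSphere.isClosedEmbedding toUnitSphere_injective

/-! ### Arcs and the region of discontinuity -/

lemma isOpen_regionOfDiscontinuity (G : Subgroup (Equiv.Perm Sphere)) :
    IsOpen (regionOfDiscontinuity G) := by
  rw [isOpen_iff_forall_mem_open]
  rintro p ⟨U, hU, hp, hf⟩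
  exact ⟨U, fun q hq => ⟨U, hU, hq, hf⟩, hU, hp⟩

lemma isOpen_Omega (μ : ℂ → ℂ) : IsOpen (Omega μ) := by
  rw [isOpen_iff_forall_mem_open]
  rintro p ⟨U, hU, hp, hf⟩
  exact ⟨U, fun q hq => ⟨U, hU, hq, hf⟩, hU, hp⟩

lemma IsLoxodromic.pow_injective {g : Equiv.Perm Sphere} (hg : IsLoxodromic g) :
    Function.Injective fun n : ℕ => g ^ n := by
  obtain ⟨B, k, hk, -, hB⟩ := hg
  have hp : ∀ n : ℕ, (g ^ n) (B • ((1 : ℂ) : Sphere)) = B • ((k ^ n : ℂ) : Sphere) := by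
    intro n
    induction n with
    | zero => simp
    | succ n ih => rw [pow_succ', Equiv.Perm.mul_apply, ih, hB, pow_succ']
  intro n m h
  have h1 : B • ((k ^ n : ℂ) : Sphere) = B • ((k ^ m : ℂ) : Sphere) := by
    rw [← hp, ← hp]
    exact congrArg (fun e : Equiv.Perm Sphere => e (B • ((1 : ℂ) : Sphere))) h
  have h2 : k ^ n = k ^ m := OnePoint.coe_injective (MulAction.injective B h1)
  have h3 : ‖k‖ ^ n = ‖k‖ ^ m := by rw [← norm_pow, ← norm_pow, h2]
  exact pow_right_injective₀ (by linarith) hk.ne' h3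

lemma not_subset_regionOfDiscontinuity {G : Subgroup (Equiv.Perm Sphere)} {α : Set Sphere}
    (hα : IsCompact α) (hne : α.Nonempty)
    (hH : IsLoxodromicCyclicOrExtension (arcStabilizer G α)) :
    ¬ α ⊆ regionOfDiscontinuity G := by
  intro hsub
  obtain ⟨g, hg, hgH⟩ := hH
  have hle : Subgroup.zpowers g ≤ arcStabilizer G α := by
    rcases hgH with h | h
    · exact h.ge
    · exact h.1
  have hmem : ∀ n : ℕ, g ^ n ∈ arcStabilizer G α := fun n =>
    hle (Subgroup.npow_mem_zpowers g n)
  obtain ⟨x, hx⟩ := hne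
  have hxn : ∀ n : ℕ, (g ^ n) x ∈ α := fun n => by
    have h1 : (g ^ n) • α = α := (hmem n).2
    rw [← h1]
    exact ⟨x, hx, rfl⟩
  obtain ⟨y, hy, hcl⟩ := hα.exists_mapClusterPt (f := atTop) (u := fun n : ℕ => (g ^ n) x)
    (tendsto_principal.2 (Eventually.of_forall hxn))
  obtain ⟨U, hU, hyU, hfin⟩ := hsub hy
  have hfreq : ∃ᶠ n in atTop, (g ^ n) x ∈ U := hcl.frequently (hU.mem_nhds hyU)
  obtain ⟨n₀, hn₀⟩ := hfreq.exists
  have hinf : {n : ℕ | (g ^ n) x ∈ U}.Infinite := Nat.frequently_atTop_iff_infinite.1 hfreq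
  refine hinf ((hfin.preimage (f := fun n : ℕ => g ^ n * (g ^ n₀)⁻¹) ?_).subset ?_)
  · intro n _ m _ h
    exact hg.pow_injective (mul_right_cancel h)
  · intro n hn
    refine ⟨G.mul_mem (hmem n).1 (G.inv_mem (hmem n₀).1), (g ^ n) x, ?_, hn⟩
    exact ⟨(g ^ n₀) x, hn₀, by simp⟩

lemma IsArcIn.isCompact {Δ α : Set Sphere} (h : IsArcIn Δ α) : IsCompact α := by
  obtain ⟨γ, hγ, -, rfl, -⟩ := h
  exact isCompact_range hγ

lemma IsArcIn.nonempty {Δ α : Set Sphere} (h : IsArcIn Δ α) : α.Nonempty := by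
  obtain ⟨γ, -, -, rfl, -⟩ := h
  exact range_nonempty γ

variable {G : Subgroup (Equiv.Perm Sphere)} {Δ : Set Sphere} {μ : ℂ → ℂ} {F F' : Set (Set Sphere)}

lemma IsNodedFamily.exists_nhds_finite (hF : IsNodedFamily G Δ μ F) {p : Sphere}
    (hp : p ∈ regionOfDiscontinuity G) :
    ∃ U, IsOpen U ∧ p ∈ U ∧ {α ∈ F | (α ∩ U).Nonempty}.Finite := by
  obtain ⟨-, -, harc, hdiam, -, -, hstab⟩ := hF
  have hn := (isOpen_regionOfDiscontinuity G).mem_nhds hp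
  rw [isClosedEmbedding_toUnitSphere.isInducing.nhds_eq_comap, mem_comap] at hn
  obtain ⟨t, ht, hts⟩ := hn
  obtain ⟨ε, hε, hb⟩ := Metric.mem_nhds_iff.1 ht
  refine ⟨toUnitSphere ⁻¹' Metric.ball (toUnitSphere p) (ε / 2),
    Metric.isOpen_ball.preimage continuous_toUnitSphere, Metric.mem_ball_self (by positivity), ?_⟩
  have hlt := hdiam.eventually (gt_mem_nhds (by positivity : 0 < ε / 2))
  rw [eventually_cofinite] at hlt
  refine (hlt.image Subtype.val).subset ?_
  rintro α ⟨hα, x, hxα, hxU⟩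
  refine ⟨⟨α, hα⟩, fun hd => ?_, rfl⟩
  have hc := (harc α hα).isCompact
  refine not_subset_regionOfDiscontinuity hc (harc α hα).nonempty (hstab α hα) fun y hy => ?_
  have h1 : dist (toUnitSphere y) (toUnitSphere x) ≤ sphericalDiam α :=
    Metric.dist_le_diam_of_mem (hc.image continuous_toUnitSphere).isBounded
      (mem_image_of_mem _ hy) (mem_image_of_mem _ hxα)
  have h2 : dist (toUnitSphere x) (toUnitSphere p) < ε / 2 := hxU
  refine hts (hb ?_)
  rw [Metric.mem_ball]
  simp only at hd
  linarith [dist_triangle (toUnitSphere y) (toUnitSphere x) (toUnitSphere p)]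

lemma IsNodedFamily.isClosed (hF : IsNodedFamily G Δ μ F) {α : Set Sphere} (hα : α ∈ F) :
    IsClosed α :=
  (hF.2.2.1 α hα).isCompact.isClosed

lemma IsNodedFamily.mem_sUnion (hF : IsNodedFamily G Δ μ F) {p : Sphere}
    (hp : p ∈ regionOfDiscontinuity G) (hpΛ : p ∈ Lambda μ) : p ∈ ⋃₀ F := by
  obtain ⟨U, hU, hpU, hfin⟩ := hF.exists_nhds_finite hp
  rw [hF.2.2.2.2.1] at hpΛ
  have hcl : IsClosed (⋃₀ {α ∈ F | (α ∩ U).Nonempty}) :=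
    sUnion_eq_biUnion ▸ hfin.isClosed_biUnion fun α hα => hF.isClosed hα.1
  have hsub : U ∩ ⋃₀ F ⊆ ⋃₀ {α ∈ F | (α ∩ U).Nonempty} := by
    rintro q ⟨hq, α, hα, hqα⟩
    exact ⟨α, ⟨hα, q, hqα, hq⟩, hqα⟩
  have h1 : p ∈ closure (U ∩ ⋃₀ F) := hU.inter_closure ⟨hpU, hpΛ⟩
  obtain ⟨α, hα, hpα⟩ := closure_minimal hsub hcl h1
  exact ⟨α, hα.1, hpα⟩

/-- Every arc of one noded family is contained in an arc of any other one with the same `μ`. -/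
lemma IsNodedFamily.exists_superset (hΔ : Δ ⊆ regionOfDiscontinuity G)
    (hF : IsNodedFamily G Δ μ F) (hF' : IsNodedFamily G Δ μ F') {α : Set Sphere} (hα : α ∈ F) :
    ∃ β ∈ F', α ⊆ β := by
  obtain ⟨γ, hγ, -, hγα, hγΔ⟩ := hF.2.2.1 α hα
  set s := γ '' Ioo 0 1 with hs
  have hspre : IsPreconnected s := (isPreconnected_Ioo).image _ hγ.continuousOn
  have hsR : s ⊆ regionOfDiscontinuity G := hγΔ.trans hΔ
  have hαΛ : α ⊆ Lambda μ := by
    rw [hF.2.2.2.2.1]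
    exact (subset_sUnion_of_mem hα).trans subset_closure
  have hsα : s ⊆ α := by rw [← hγα]; exact image_subset_range _ _
  have hsF' : s ⊆ ⋃₀ F' := fun p hp => hF'.mem_sUnion (hsR hp) (hαΛ (hsα hp))
  have hαs : α ⊆ closure s := by
    rw [← hγα, ← image_univ]
    have : (univ : Set unitInterval) = closure (Ioo 0 1) := by
      rw [closure_Ioo zero_ne_one]
      ext x
      exact ⟨fun _ => ⟨x.2.1, x.2.2⟩, fun _ => mem_univ x⟩
    rw [this]
    exact image_closure_subset_closure_image hγ
  obtain ⟨p₀, hp₀⟩ : s.Nonempty :=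
    closure_nonempty_iff.1 ((hF.2.2.1 α hα).nonempty.mono hαs)
  obtain ⟨β, hβ, hpβ⟩ := hsF' hp₀
  refine ⟨β, hβ, hαs.trans (closure_minimal ?_ (hF'.isClosed hβ))⟩
  set u : Set Sphere := {x | ∃ U, IsOpen U ∧ x ∈ U ∧ U ∩ s ⊆ β}
  have huo : IsOpen u := by
    rw [isOpen_iff_forall_mem_open]
    rintro x ⟨U, hU, hxU, hUs⟩
    exact ⟨U, fun y hy => ⟨U, hU, hy, hUs⟩, hU, hxU⟩
  have hus : s ∩ u ⊆ β := by
    rintro x ⟨hx, U, -, hxU, hUs⟩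
    exact hUs ⟨hxU, hx⟩
  have hcov : s ⊆ u ∪ βᶜ := by
    intro x hx
    by_cases hxβ : x ∈ β
    · left
      obtain ⟨U, hU, hxU, hfin⟩ := hF'.exists_nhds_finite (hsR hx)
      have hfin' : {α ∈ F' | (α ∩ U).Nonempty ∧ α ≠ β}.Finite :=
        hfin.subset fun α h => ⟨h.1, h.2.1⟩
      have hcl : IsClosed (⋃₀ {α ∈ F' | (α ∩ U).Nonempty ∧ α ≠ β}) :=
        sUnion_eq_biUnion ▸ hfin'.isClosed_biUnion fun α hα => hF'.isClosed hα.1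
      refine ⟨U ∩ (⋃₀ {α ∈ F' | (α ∩ U).Nonempty ∧ α ≠ β})ᶜ, hU.inter hcl.isOpen_compl,
        ⟨hxU, ?_⟩, ?_⟩
      · rintro ⟨α', ⟨hα', -, hne⟩, hxα'⟩
        exact (hF'.2.1 hα' hβ hne).le_bot ⟨hxα', hxβ⟩
      · rintro y ⟨⟨hyU, hy⟩, hys⟩
        obtain ⟨α', hα', hyα'⟩ := hsF' hys
        by_contra hyβ
        exact hy ⟨α', ⟨hα', ⟨y, hyα', hyU⟩, fun h => hyβ (h ▸ hyα')⟩, hyα'⟩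
    · exact Or.inr hxβ
  rcases isPreconnected_iff_subset_of_disjoint.1 hspre u βᶜ huo (hF'.isClosed hβ).isOpen_compl hcov
    (eq_empty_of_forall_notMem fun x hx => hx.2.2 (hus ⟨hx.1, hx.2.1⟩)) with h | h
  · exact fun x hx => hus ⟨hx, h hx⟩
  · exact absurd hpβ (h hp₀)

/-! ### Fibres of a noded deformation -/

/-- A piece of the preimage of a disc that misses the boundary circle is everything or nothing. -/
lemma eq_univ_of_preimage_ball {w : Sphere → Sphere} (hw : Continuous w) {U U' : Set Sphere}
    (hU : IsOpen U) (hU' : IsOpen U') (hd : Disjoint U U') {y : ℂ} {r : ℝ}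
    (hcov : ∀ q, w q ∈ ((↑) : ℂ → Sphere) '' Metric.closedBall y r → q ∈ U ∪ U')
    (hmiss : ∀ q ∈ U, w q ∉ ((↑) : ℂ → Sphere) '' Metric.sphere y r)
    (hne : (U ∩ w ⁻¹' (((↑) : ℂ → Sphere) '' Metric.ball y r)).Nonempty) : U' = ∅ := by
  have ho : IsOpen (U ∩ w ⁻¹' (((↑) : ℂ → Sphere) '' Metric.ball y r)) :=
    hU.inter ((OnePoint.isOpen_image_coe.2 Metric.isOpen_ball).preimage hw)
  have he : U ∩ w ⁻¹' (((↑) : ℂ → Sphere) '' Metric.ball y r) =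
      w ⁻¹' (((↑) : ℂ → Sphere) '' Metric.closedBall y r) ∩ U'ᶜ := by
    ext q
    constructor
    · rintro ⟨hq, hqb⟩
      exact ⟨image_mono Metric.ball_subset_closedBall hqb, fun h => hd.le_bot ⟨hq, h⟩⟩
    · rintro ⟨hq, hqU'⟩
      have hqU := (hcov q hq).resolve_right hqU'
      refine ⟨hqU, ?_⟩
      obtain ⟨x, hx, hxq⟩ := hq
      rw [← Metric.ball_union_sphere] at hx
      rcases hx with hx | hx
      · exact ⟨x, hx, hxq⟩
      · exact absurd ⟨x, hx, hxq⟩ (hmiss q hqU)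
  have hc : IsClosed (U ∩ w ⁻¹' (((↑) : ℂ → Sphere) '' Metric.ball y r)) := by
    rw [he]
    refine IsClosed.inter (IsClosed.preimage hw ?_) hU'.isClosed_compl
    exact ((isCompact_closedBall y r).image OnePoint.continuous_coe).isClosed
  have huniv := (isClopen_iff.1 ⟨hc, ho⟩).resolve_left hne.ne_empty
  refine eq_empty_of_forall_notMem fun q hq => ?_
  have : q ∈ U ∩ w ⁻¹' (((↑) : ℂ → Sphere) '' Metric.ball y r) := huniv ▸ mem_univ q
  exact hd.le_bot ⟨this.1, hq⟩

lemma mem_of_apply_eq_of_ne_infty {w : Sphere → Sphere} (hw : Continuous w)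
    (hsurj : Function.Surjective w) (hFc : F.Countable) (hcl : ∀ α ∈ F, IsClosed α)
    (hinj : InjOn w (⋃₀ F)ᶜ) {c : F → Sphere} (hc : Function.Injective c)
    (hwc : ∀ α : F, ∀ p ∈ (α : Set Sphere), w p = c α) (α : F) (hne : (α : Set Sphere).Nonempty)
    (hinf : c α ≠ OnePoint.infty) {p : Sphere} (hp : w p = c α) : p ∈ (α : Set Sphere) := by
  by_contra hpα
  have hmem : ∀ q β, β ∈ F → q ∈ β → w q = c α → q ∈ (α : Set Sphere) := by
    intro q β hβ hq h
    have : (⟨β, hβ⟩ : F) = α := hc ((hwc ⟨β, hβ⟩ q hq).symm.trans h)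
    rwa [← this]
  have hpF : p ∉ ⋃₀ F := fun ⟨β, hβ, hq⟩ => hpα (hmem p β hβ hq hp)
  have hfib : ∀ q, w q = c α → q ∈ (α : Set Sphere) ∨ q = p := by
    intro q hq
    by_cases hqF : q ∈ ⋃₀ F
    · obtain ⟨β, hβ, hqβ⟩ := hqF
      exact Or.inl (hmem q β hβ hqβ hq)
    · exact Or.inr (hinj hqF hpF (hq.trans hp.symm))
  obtain ⟨y, hy⟩ := OnePoint.ne_infty_iff_exists.1 hinf
  obtain ⟨U₁, U₂, hU₁, hU₂, hαU, hpU, hd⟩ := SeparatedNhds.of_isCompact_isCompact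
    (hcl α α.2).isCompact isCompact_singleton (disjoint_singleton_right.2 hpα)
  rw [singleton_subset_iff] at hpU
  have hK : IsClosed (w '' (U₁ ∪ U₂)ᶜ) :=
    ((hU₁.union hU₂).isClosed_compl.isCompact.image hw).isClosed
  have hyK : (y : Sphere) ∉ w '' (U₁ ∪ U₂)ᶜ := by
    rintro ⟨q, hq, hqy⟩
    rcases hfib q (hqy.trans hy) with h | h
    · exact hq (Or.inl (hαU h))
    · exact hq (Or.inr (h ▸ hpU))
  obtain ⟨R, hR, hball⟩ := Metric.nhds_basis_closedBall.mem_iff.1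
    ((hK.isOpen_compl.preimage OnePoint.continuous_coe).mem_nhds hyK)
  have : Countable F := hFc.to_subtype
  have hbad : (range fun β : F => dist (toC (c β)) y).Countable := countable_range _
  obtain ⟨r, ⟨hr0, hrR⟩, hr⟩ := (hbad.dense_compl ℝ).inter_open_nonempty _ isOpen_Ioo
    (nonempty_Ioo.2 hR)
  have hcov : ∀ q, w q ∈ ((↑) : ℂ → Sphere) '' Metric.closedBall y r → q ∈ U₁ ∪ U₂ := by
    rintro q ⟨x, hx, hxq⟩
    by_contra hq
    exact hball (Metric.closedBall_subset_closedBall hrR.le hx) ⟨q, hq, hxq.symm⟩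
  set C := ((↑) : ℂ → Sphere) '' Metric.sphere y r with hC
  have hCc : IsClosed C := ((isCompact_sphere y r).image OnePoint.continuous_coe).isClosed
  have hCconn : IsPreconnected C :=
    (isPreconnected_sphere (by simp [Complex.rank_real_complex]) y r).image _
      OnePoint.continuous_coe.continuousOn
  have hCF : ∀ q, w q ∈ C → q ∉ ⋃₀ F := by
    rintro q ⟨x, hx, hxq⟩ ⟨β, hβ, hqβ⟩
    refine hr ⟨⟨β, hβ⟩, ?_⟩
    simp only
    rw [← hwc ⟨β, hβ⟩ q hqβ, ← hxq, toC_coe]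
    exact hx
  have hCinj : ∀ q q', w q ∈ C → w q = w q' → q = q' := fun q q' hq h =>
    hinj (hCF q hq) (hCF q' (h ▸ hq)) h
  have hclosed : ∀ U U' : Set Sphere, IsOpen U' → Disjoint U U' →
      (∀ q, w q ∈ C → q ∈ U ∪ U') → IsClosed (w '' (w ⁻¹' C ∩ U)) := by
    intro U U' hU' hd hcov
    have : w ⁻¹' C ∩ U = w ⁻¹' C ∩ U'ᶜ := by
      ext q
      exact ⟨fun h => ⟨h.1, fun h' => hd.le_bot ⟨h.2, h'⟩⟩,
        fun h => ⟨h.1, (hcov q h.1).resolve_right h.2⟩⟩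
    rw [this]
    exact (((hCc.preimage hw).inter hU'.isClosed_compl).isCompact.image hw).isClosed
  have hcovC : ∀ q, w q ∈ C → q ∈ U₁ ∪ U₂ := fun q hq =>
    hcov q (image_mono Metric.sphere_subset_closedBall hq)
  have hmiss : ∀ U U' : Set Sphere, Disjoint U U' → C ⊆ w '' (w ⁻¹' C ∩ U') →
      ∀ q ∈ U, w q ∉ C := by
    intro U U' hd hCU q hq hqC
    obtain ⟨q', hq', he⟩ := hCU hqC
    rw [hCinj q q' hqC he.symm] at hq
    exact hd.le_bot ⟨hq, hq'.2⟩
  have hyb : (y : Sphere) ∈ ((↑) : ℂ → Sphere) '' Metric.ball y r :=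
    mem_image_of_mem _ (Metric.mem_ball_self hr0)
  obtain ⟨a, ha⟩ := hne
  rcases isPreconnected_iff_subset_of_disjoint_closed.1 hCconn _ _
    (hclosed U₁ U₂ hU₂ hd hcovC) (hclosed U₂ U₁ hU₁ hd.symm fun q hq => (hcovC q hq).symm)
    (fun x hx => by
      obtain ⟨q, rfl⟩ := hsurj x
      rcases hcovC q hx with h | h
      · exact Or.inl ⟨q, ⟨hx, h⟩, rfl⟩
      · exact Or.inr ⟨q, ⟨hx, h⟩, rfl⟩)
    (eq_empty_of_forall_notMem fun x hx => by
      obtain ⟨hxC, ⟨q, hq, rfl⟩, ⟨q', hq', he⟩⟩ := hx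
      have := hCinj q q' hq.1 he.symm
      subst this
      exact hd.le_bot ⟨hq.2, hq'.2⟩) with h | h
  · have := eq_univ_of_preimage_ball hw hU₂ hU₁ hd.symm (fun q hq => (hcov q hq).symm)
      (hmiss U₂ U₁ hd.symm h) ⟨p, hpU, by rw [mem_preimage, hp, ← hy]; exact hyb⟩
    exact notMem_empty a (this ▸ hαU ha)
  · have := eq_univ_of_preimage_ball hw hU₁ hU₂ hd hcov (hmiss U₁ U₂ hd h)
      ⟨a, hαU ha, by rw [mem_preimage, hwc α a ha, ← hy]; exact hyb⟩
    exact notMem_empty p (this ▸ hpU)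

lemma mem_of_apply_eq {w : Sphere → Sphere} (hw : Continuous w)
    (hsurj : Function.Surjective w) (hFc : F.Countable) (hcl : ∀ α ∈ F, IsClosed α)
    (hinj : InjOn w (⋃₀ F)ᶜ) {c : F → Sphere} (hc : Function.Injective c)
    (hwc : ∀ α : F, ∀ p ∈ (α : Set Sphere), w p = c α) (α : F) (hne : (α : Set Sphere).Nonempty)
    {p : Sphere} (hp : w p = c α) : p ∈ (α : Set Sphere) := by
  obtain ⟨j, hj⟩ := exists_coord_ne_infty (c α)
  refine mem_of_apply_eq_of_ne_infty (w := coord j ∘ w) (c := coord j ∘ c)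
    ((continuous_coord j).comp hw)
    ((Function.Involutive.surjective (coord_coord j)).comp hsurj) hFc hcl
    (fun x hx y hy h => hinj hx hy (coord_injective j h)) ((coord_injective j).comp hc)
    (fun β q hq => congrArg (coord j) (hwc β q hq)) α hne hj (congrArg (coord j) hp)

end NodedQC

namespace NodedQC

variable {G : Subgroup (Equiv.Perm Sphere)} {Δ : Set Sphere} {μ : ℂ → ℂ} {F : Set (Set Sphere)}

lemma disjoint_Omega_sUnion (hF : IsNodedFamily G Δ μ F) : Omega μ ⊆ (⋃₀ F)ᶜ := by
  intro p hp hpF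
  have h : p ∈ Lambda μ := by
    rw [hF.2.2.2.2.1]
    exact subset_closure hpF
  exact h hp

lemma surjective_of_noded {w : Sphere → Sphere} (hw : Continuous w) (hF : IsNodedFamily G Δ μ F)
    (hinj : InjOn w (⋃₀ F)ᶜ) (hor : PreservesOrientationOn w (Omega μ)) {c : F → Sphere}
    (hwc : ∀ α : F, ∀ p ∈ (α : Set Sphere), w p = c α) : Function.Surjective w := by
  have hΩ := isOpen_Omega μ
  have hinjΩ : InjOn w (Omega μ) := hinj.mono (disjoint_Omega_sUnion hF)
  have : Countable F := hF.1.to_subtype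
  set A : Set ℂ := {z | (z : Sphere) ∈ Omega μ} with hA
  have hAo : IsOpen A := hΩ.preimage OnePoint.continuous_coe
  have hAne : A.Nonempty := by
    obtain ⟨_, hp, z, rfl⟩ := (OnePoint.denseRange_coe (X := ℂ)).inter_open_nonempty _ hΩ
      hF.2.2.2.2.2.1.nonempty
    exact ⟨z, hp⟩
  have hbad : {z ∈ A | w z ∈ insert OnePoint.infty (range c)}.Countable :=
    MapsTo.countable_of_injOn (f := fun z : ℂ => w z) (fun z hz => hz.2)
      (fun x hx y hy h => OnePoint.coe_injective (hinjΩ hx.1 hy.1 h))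
      ((countable_range c).insert _)
  obtain ⟨z₀, hz₀, hgood⟩ := (hbad.dense_compl ℝ).inter_open_nonempty _ hAo hAne
  have hgood : w z₀ ∉ insert OnePoint.infty (range c) := fun h => hgood ⟨hz₀, h⟩
  have h1 : w z₀ ≠ OnePoint.infty := fun h => hgood (Or.inl h)
  have h2 : ∀ p, w p = w z₀ → p = z₀ := by
    intro p hp
    refine hinj (fun ⟨α, hα, hpα⟩ => hgood (Or.inr ⟨⟨α, hα⟩, ?_⟩))
      (disjoint_Omega_sUnion hF hz₀) hp
    rw [← hwc ⟨α, hα⟩ p hpα, hp]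
  exact surjective_of_hasLocalDegreeOne hw h1 h2
    (hor z₀ hz₀ ⟨Omega μ, hΩ.mem_nhds hz₀, hinjΩ⟩ false false z₀ rfl h1)

lemma IsNodedDeformation.exists_fibres {w : Sphere → Sphere} (h : IsNodedDeformation G Δ μ w) :
    Function.Surjective w ∧ ∃ F, IsNodedFamily G Δ μ F ∧
      ∀ p q, w p = w q ↔ p = q ∨ ∃ α ∈ F, p ∈ α ∧ q ∈ α := by
  obtain ⟨hw, F, hF, hinj, hq, c, hc, hwc⟩ := h
  have hsurj := surjective_of_noded hw hF hinj hq.2.1 hwc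
  have hmem : ∀ (α : F) p, w p = c α → p ∈ (α : Set Sphere) := fun α p hp =>
    mem_of_apply_eq hw hsurj hF.1 (fun β hβ => hF.isClosed hβ) hinj hc hwc α
      (hF.2.2.1 α α.2).nonempty hp
  refine ⟨hsurj, F, hF, fun p q => ⟨fun hpq => ?_, ?_⟩⟩
  · by_cases hp : p ∈ ⋃₀ F
    · obtain ⟨α, hα, hpα⟩ := hp
      exact Or.inr ⟨α, hα, hpα, hmem ⟨α, hα⟩ q (by rw [← hpq, hwc ⟨α, hα⟩ p hpα])⟩
    · by_cases hq : q ∈ ⋃₀ F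
      · obtain ⟨α, hα, hqα⟩ := hq
        exact Or.inr ⟨α, hα, hmem ⟨α, hα⟩ p (by rw [hpq, hwc ⟨α, hα⟩ q hqα]), hqα⟩
      · exact Or.inl (hinj hp hq hpq)
  · rintro (rfl | ⟨α, hα, hp, hq⟩)
    · rfl
    · rw [hwc ⟨α, hα⟩ p hp, hwc ⟨α, hα⟩ q hq]

lemma IsNodedDeformation.eq_of_mem_Omega {w : Sphere → Sphere} (h : IsNodedDeformation G Δ μ w)
    {p q : Sphere} (hp : p ∈ Omega μ) (hpq : w p = w q) : p = q := by
  obtain ⟨-, F, hF, hfib⟩ := h.exists_fibres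
  rcases (hfib p q).1 hpq with rfl | ⟨α, hα, hpα, -⟩
  · rfl
  · exact absurd ⟨α, hα, hpα⟩ (disjoint_Omega_sUnion hF hp)

lemma IsNodedDeformation.isOpen_image {w : Sphere → Sphere} (h : IsNodedDeformation G Δ μ w)
    {O : Set Sphere} (hO : IsOpen O) (hOΩ : O ⊆ Omega μ) : IsOpen (w '' O) := by
  have e : w '' O = (w '' Oᶜ)ᶜ := by
    ext x
    constructor
    · rintro ⟨p, hp, rfl⟩ ⟨q, hq, hqp⟩
      exact hq (h.eq_of_mem_Omega (hOΩ hp) hqp.symm ▸ hp)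
    · intro hx
      obtain ⟨p, rfl⟩ := h.exists_fibres.1 x
      by_contra hp
      exact hx ⟨p, fun hpO => hp ⟨p, hpO, rfl⟩, rfl⟩
  rw [e]
  exact (hO.isClosed_compl.isCompact.image h.1).isClosed.isOpen_compl

lemma IsNodedDeformation.apply_eq_of_apply_eq (hΔ : Δ ⊆ regionOfDiscontinuity G)
    {w₁ w₂ : Sphere → Sphere} (h₁ : IsNodedDeformation G Δ μ w₁)
    (h₂ : IsNodedDeformation G Δ μ w₂) {p q : Sphere} (h : w₁ p = w₁ q) : w₂ p = w₂ q := by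
  obtain ⟨-, F₁, hF₁, hf₁⟩ := h₁.exists_fibres
  obtain ⟨-, F₂, hF₂, hf₂⟩ := h₂.exists_fibres
  rcases (hf₁ p q).1 h with rfl | ⟨α, hα, hp, hq⟩
  · rfl
  · obtain ⟨β, hβ, hαβ⟩ := hF₁.exists_superset hΔ hF₂ hα
    exact (hf₂ p q).2 (Or.inr ⟨β, hβ, hαβ hp, hαβ hq⟩)

lemma IsNodedDeformation.exists_homeomorph (hΔ : Δ ⊆ regionOfDiscontinuity G)
    {w₁ w₂ : Sphere → Sphere} (h₁ : IsNodedDeformation G Δ μ w₁)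
    (h₂ : IsNodedDeformation G Δ μ w₂) : ∃ T : Sphere ≃ₜ Sphere, ∀ p, T (w₁ p) = w₂ p := by
  have s₁ := h₁.exists_fibres.1
  have s₂ := h₂.exists_fibres.1
  let t : Sphere → Sphere := fun x => w₂ (Function.surjInv s₁ x)
  have ht : ∀ p, t (w₁ p) = w₂ p := fun p =>
    h₁.apply_eq_of_apply_eq hΔ h₂ (Function.surjInv_eq s₁ (w₁ p))
  have htc : Continuous t := by
    rw [(h₁.1.isClosedMap.isQuotientMap h₁.1 s₁).continuous_iff]
    exact h₂.1.congr fun p => (ht p).symm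
  have htb : Function.Bijective t := by
    constructor
    · intro x y hxy
      obtain ⟨p, rfl⟩ := s₁ x
      obtain ⟨q, rfl⟩ := s₁ y
      rw [ht, ht] at hxy
      exact h₂.apply_eq_of_apply_eq hΔ h₁ hxy
    · intro y
      obtain ⟨p, rfl⟩ := s₂ y
      exact ⟨w₁ p, ht p⟩
  exact ⟨Continuous.homeoOfEquivCompactToT2 (f := Equiv.ofBijective t htb) htc, ht⟩

/-! ### Conformality -/

lemma HasL2WeakDerivOn.mono {f a b : ℂ → ℂ} {V W : Set ℂ} (h : HasL2WeakDerivOn f V a b)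
    (hW : W ⊆ V) : HasL2WeakDerivOn f W a b :=
  ⟨fun K hK hKW => h.1 K hK (hKW.trans hW), fun φ hφ hc hs => h.2 φ hφ hc (hs.trans hW)⟩

lemma coe_rep {f : Sphere → Sphere} {i j : Bool} {z : ℂ}
    (h : coord j (f (coord i (z : Sphere))) ≠ OnePoint.infty) :
    (rep f i j z : Sphere) = coord j (f (coord i (z : Sphere))) := coe_toC h

lemma isOpen_repDomain {f : Sphere → Sphere} (hf : Continuous f) {U : Set Sphere} (hU : IsOpen U)
    (i j : Bool) : IsOpen (repDomain f U i j) := by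
  have hc : Continuous fun z : ℂ => coord i (z : Sphere) :=
    (continuous_coord i).comp OnePoint.continuous_coe
  exact (hU.preimage hc).inter
    (OnePoint.isClosed_infty.isOpen_compl.preimage ((continuous_coord j).comp (hf.comp hc)))

lemma continuousOn_rep {f : Sphere → Sphere} (hf : Continuous f) (U : Set Sphere) (i j : Bool) :
    ContinuousOn (rep f i j) (repDomain f U i j) := by
  have hc : Continuous fun z : ℂ => coord i (z : Sphere) :=
    (continuous_coord i).comp OnePoint.continuous_coe
  exact continuousOn_toC.comp ((continuous_coord j).comp (hf.comp hc)).continuousOn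
    fun z hz => hz.2

lemma exists_norm_lt_one {z₀ : ℂ} (hz₀ : (z₀ : Sphere) ∈ Omega μ) :
    ∃ N : Set ℂ, IsOpen N ∧ z₀ ∈ N ∧ ∀ᵐ z, z ∈ N → ‖μ z‖ < 1 := by
  obtain ⟨U, hU, hzU, hlt⟩ := hz₀
  have hN : IsOpen {z : ℂ | (z : Sphere) ∈ U} := hU.preimage OnePoint.continuous_coe
  refine ⟨_, hN, hzU, ?_⟩
  rw [← ae_restrict_iff' hN.measurableSet]
  rw [eLpNorm_exponent_top] at hlt
  filter_upwards [ae_lt_of_essSup_lt hlt] with z hz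
  rw [← ofReal_norm, ENNReal.ofReal_lt_one] at hz
  exact hz

/-- At a finite point of `Ω(μ)`, the transition map between two solutions is holomorphic. -/
lemma differentiableAt_rep {w₁ w₂ T : Sphere → Sphere} (hw₁ : Continuous w₁)
    (hw₂ : Continuous w₂) (hT : Continuous T) (hTw : ∀ p, T (w₁ p) = w₂ p)
    (hinj : InjOn w₁ (Omega μ)) (hopen : ∀ O ⊆ Omega μ, IsOpen O → IsOpen (w₁ '' O))
    (hb₁ : SolvesBeltramiOn μ w₁ (Omega μ)) (hb₂ : SolvesBeltramiOn μ w₂ (Omega μ))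
    {i j : Bool} {z x : ℂ} (hx : (x : Sphere) ∈ Omega μ) (hzx : coord i (z : Sphere) = w₁ x)
    (hz : coord j (T (coord i (z : Sphere))) ≠ OnePoint.infty) :
    DifferentiableAt ℂ (rep T i j) z := by
  obtain ⟨N, hN, hxN, hμ⟩ := exists_norm_lt_one hx
  obtain ⟨a₁, b₁, hd₁, he₁⟩ := hb₁ i
  obtain ⟨a₂, b₂, hd₂, he₂⟩ := hb₂ j
  have hΩ := isOpen_Omega μ
  set V := repDomain w₁ (Omega μ) false i ∩ repDomain w₂ (Omega μ) false j ∩ N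
  have hV : IsOpen V :=
    ((isOpen_repDomain hw₁ hΩ _ _).inter (isOpen_repDomain hw₂ hΩ _ _)).inter hN
  have hV1 : V ⊆ repDomain w₁ (Omega μ) false i := fun _ h => h.1.1
  have hV2 : V ⊆ repDomain w₂ (Omega μ) false j := fun _ h => h.1.2
  have hfx : ∀ y ∈ V, coord i (rep w₁ false i y : Sphere) = w₁ y := by
    intro y hy
    rw [coe_rep (hV1 hy).2, coord_coord]
    rfl
  have hzc : coord i (w₁ x) = z := by rw [← hzx, coord_coord]
  have hxV : x ∈ V := by
    refine ⟨⟨⟨hx, ?_⟩, hx, ?_⟩, hxN⟩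
    · show coord i (w₁ x) ≠ OnePoint.infty
      rw [hzc]; exact OnePoint.coe_ne_infty z
    · show coord j (w₂ x) ≠ OnePoint.infty
      rwa [← hTw, ← hzx]
  have hfz : rep w₁ false i x = z := by
    show toC (coord i (w₁ x)) = z
    rw [hzc, toC_coe]
  have hTf : ∀ y ∈ V, T (coord i (rep w₁ false i y : Sphere)) = w₂ y := fun y hy => by
    rw [hfx y hy, hTw]
  rw [← hfz]
  refine differentiableAt_of_solves_same_beltrami (f := rep w₁ false i) (g := rep w₂ false j)
    (μ := μ) hV ((continuousOn_rep hw₁ _ _ _).mono hV1) ((continuousOn_rep hw₂ _ _ _).mono hV2)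
    ?_ ?_ ?_ ?_ (hd₁.mono hV1) (hd₂.mono hV2) ?_ ?_ ?_ hxV
  · intro y hy y' hy' h
    have h1 : w₁ y = w₁ y' := by rw [← hfx y hy, ← hfx y' hy', h]
    exact OnePoint.coe_injective (hinj (hV1 hy).1 (hV1 hy').1 h1)
  · intro O hO hOo
    have e : rep w₁ false i '' O =
        (fun z : ℂ => coord i (z : Sphere)) ⁻¹' (w₁ '' (((↑) : ℂ → Sphere) '' O)) := by
      ext y
      constructor
      · rintro ⟨y', hy', rfl⟩
        exact ⟨y', ⟨y', hy', rfl⟩, (hfx y' (hO hy')).symm⟩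
      · rintro ⟨_, ⟨y', hy', rfl⟩, h⟩
        refine ⟨y', hy', ?_⟩
        show toC (coord i (w₁ y')) = y
        rw [h]
        simp only
        rw [coord_coord, toC_coe]
    rw [e]
    refine (hopen _ ?_ (OnePoint.isOpen_image_coe.2 hOo)).preimage
      ((continuous_coord i).comp OnePoint.continuous_coe)
    rintro _ ⟨y, hy, rfl⟩
    exact (hV1 (hO hy)).1
  · refine (continuousOn_rep hT univ i j).mono ?_
    rintro _ ⟨y, hy, rfl⟩
    refine ⟨mem_univ _, ?_⟩
    rw [hTf y hy]
    exact (hV2 hy).2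
  · intro y hy
    show toC (coord j (T (coord i (rep w₁ false i y : Sphere)))) = toC (coord j (w₂ y))
    rw [hTf y hy]
  · exact he₁.mono fun y h hy => h (hV1 hy)
  · exact he₂.mono fun y h hy => h (hV2 hy)
  · exact hμ.mono fun y h hy => h hy.2

lemma IsNodedDeformation.isConformalFromOnto {w₁ w₂ : Sphere → Sphere}
    (h₁ : IsNodedDeformation G Δ μ w₁) (h₂ : IsNodedDeformation G Δ μ w₂) (T : Sphere ≃ₜ Sphere)
    (hTw : ∀ p, T (w₁ p) = w₂ p) :
    IsConformalFromOnto T (w₁ '' Omega μ) (w₂ '' Omega μ) := by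
  have hΩ := isOpen_Omega μ
  have hUo : IsOpen (w₁ '' Omega μ) := h₁.isOpen_image hΩ subset_rfl
  have hb₁ : SolvesBeltramiOn μ w₁ (Omega μ) := by
    obtain ⟨-, F, -, -, hq, -⟩ := h₁
    exact hq.2.2.2.1
  have hb₂ : SolvesBeltramiOn μ w₂ (Omega μ) := by
    obtain ⟨-, F, -, -, hq, -⟩ := h₂
    exact hq.2.2.2.1
  have hfin : ∀ {i j : Bool} {z x : ℂ}, (x : Sphere) ∈ Omega μ →
      coord i (z : Sphere) = w₁ x → coord j (T (coord i (z : Sphere))) ≠ OnePoint.infty →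
      DifferentiableAt ℂ (rep T i j) z := fun hx hzx hz =>
    differentiableAt_rep h₁.1 h₂.1 T.continuous hTw
      (fun p hp q _ h => h₁.eq_of_mem_Omega hp h) (fun O hO hOo => h₁.isOpen_image hOo hO)
      hb₁ hb₂ hx hzx hz
  refine ⟨hUo, ⟨?_, T.injective.injOn, ?_⟩, fun i j z hz => ?_⟩
  · rintro _ ⟨p, hp, rfl⟩
    exact ⟨p, hp, (hTw p).symm⟩
  · rintro _ ⟨p, hp, rfl⟩
    exact ⟨w₁ p, ⟨p, hp, rfl⟩, hTw p⟩
  · have hD := isOpen_repDomain T.continuous hUo i j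
    have hev : ∀ᶠ z' in 𝓝[≠] z, DifferentiableAt ℂ (rep T i j) z' ∨
        coord i (z' : Sphere) = w₁ OnePoint.infty := by
      filter_upwards [nhdsWithin_le_nhds (hD.mem_nhds hz)] with z' hz'
      obtain ⟨⟨p, hp, hpz⟩, hz'2⟩ := hz'
      induction p using OnePoint.rec with
      | infty => exact Or.inr hpz.symm
      | coe x => exact Or.inl (hfin hp hpz.symm hz'2)
    obtain ⟨⟨p, hp, hpz⟩, hz2⟩ := hz
    induction p using OnePoint.rec with
    | coe x => exact hfin hp hpz.symm hz2
    | infty =>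
      refine (Complex.analyticAt_of_differentiable_on_punctured_nhds_of_continuousAt ?_
        ((continuousOn_rep T.continuous _ i j).continuousAt
          (hD.mem_nhds ⟨⟨_, hp, hpz⟩, hz2⟩))).differentiableAt
      filter_upwards [hev, self_mem_nhdsWithin] with z' hz' hne
      refine hz'.resolve_right fun h => hne ?_
      exact OnePoint.coe_injective (coord_injective i (h.trans hpz))

/-! ### Orientation -/

lemma preservesOrientationOn_of_conformal (T : Sphere ≃ₜ Sphere) {U V : Set Sphere}
    (hT : IsConformalFromOnto T U V) (hU : Dense U) : PreservesOrientationOn T univ := by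
  intro p _ _ i j z hz hj
  have hzD : z ∈ repDomain T univ i j := ⟨mem_univ _, by rwa [hz]⟩
  have hDo := isOpen_repDomain T.continuous isOpen_univ i j
  obtain ⟨R, hR, hb⟩ := Metric.mem_nhds_iff.1 (hDo.mem_nhds hzD)
  have hinj : InjOn (rep T i j) (Metric.ball z R) := by
    intro x hx y hy h
    have h1 := congrArg ((↑) : ℂ → Sphere) h
    rw [coe_rep (hb hx).2, coe_rep (hb hy).2] at h1
    exact OnePoint.coe_injective (coord_injective i (T.injective (coord_injective j h1)))
  have hEo : IsOpen (Metric.ball z R ∩ (fun x : ℂ => coord i (x : Sphere)) ⁻¹' U) :=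
    Metric.isOpen_ball.inter (hT.1.preimage ((continuous_coord i).comp OnePoint.continuous_coe))
  have hEne : (Metric.ball z R ∩ (fun x : ℂ => coord i (x : Sphere)) ⁻¹' U).Nonempty := by
    have ho : IsOpen (coord i ⁻¹' (((↑) : ℂ → Sphere) '' Metric.ball z R)) :=
      (OnePoint.isOpen_image_coe.2 Metric.isOpen_ball).preimage (continuous_coord i)
    obtain ⟨q, ⟨x, hx, hxq⟩, hqU⟩ := hU.inter_open_nonempty _ ho
      ⟨coord i (z : Sphere), z, Metric.mem_ball_self hR, (coord_coord i _).symm⟩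
    refine ⟨x, hx, ?_⟩
    rw [mem_preimage, hxq, coord_coord]
    exact hqU
  obtain ⟨z₂, hz₂⟩ := hEne
  obtain ⟨s, hs, hsb⟩ := Metric.mem_nhds_iff.1 (hEo.mem_nhds hz₂)
  have hd : ∀ x ∈ Metric.ball z₂ s, DifferentiableAt ℂ (rep T i j) x := fun x hx =>
    hT.2.2 i j x ⟨(hsb hx).2, (hb (hsb hx).1).2⟩
  obtain ⟨z₁, hz₁, hne⟩ : ∃ z₁ ∈ Metric.ball z₂ s, deriv (rep T i j) z₁ ≠ 0 := by
    by_contra! hcon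
    have hx : z₂ + (s / 2 : ℝ) ∈ Metric.ball z₂ s := by
      rw [Metric.mem_ball, dist_eq_norm, add_sub_cancel_left, Complex.norm_real,
        Real.norm_of_nonneg (by positivity)]
      linarith
    have h1 := Metric.isOpen_ball.is_const_of_deriv_eq_zero (convex_ball z₂ s).isPreconnected
      (fun x hx => (hd x hx).differentiableWithinAt) hcon hx (Metric.mem_ball_self hs)
    have h2 := hinj (hsb hx).1 hz₂.1 h1
    have h3 : ((s / 2 : ℝ) : ℂ) = 0 := by simpa using h2
    have h4 : s / 2 = 0 := by exact_mod_cast h3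
    linarith
  obtain ⟨R₁, hR₁, hb₁⟩ := Metric.mem_nhds_iff.1 (Metric.isOpen_ball.mem_nhds hz₁)
  exact (hasLocalDegreeOne_of_deriv_ne_zero hR₁
    (fun x hx => (hd x (hb₁ hx)).differentiableWithinAt) hne).transfer
    ((continuousOn_rep T.continuous univ i j).mono hb) hinj (hsb hz₁).1

end NodedQC

end

theorem lemma2 (G : Subgroup (Equiv.Perm NodedQC.Sphere)) (hG : NodedQC.IsKleinian G)
    (hfg : G.FG) (Δ : Set NodedQC.Sphere) (hΔ : NodedQC.IsInvariantUnionOfComponents G Δ)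
    (μ : ℂ → ℂ) (hμ : NodedQC.MemClosedBall G Δ μ) (w₁ w₂ : NodedQC.Sphere → NodedQC.Sphere)
    (h₁ : NodedQC.IsNodedDeformation G Δ μ w₁) (h₂ : NodedQC.IsNodedDeformation G Δ μ w₂) :
    ∃ T : NodedQC.Sphere ≃ₜ NodedQC.Sphere,
      NodedQC.PreservesOrientationOn T univ ∧
      NodedQC.IsConformalFromOnto T (w₁ '' NodedQC.Omega μ) (w₂ '' NodedQC.Omega μ) ∧
      T ∘ w₁ = w₂ := by
  obtain ⟨T, hT⟩ := h₁.exists_homeomorph hΔ.2.1 h₂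
  have hconf := h₁.isConformalFromOnto h₂ T hT
  have hdense : Dense (NodedQC.Omega μ) := by
    obtain ⟨-, F, hF, -⟩ := h₁
    exact hF.2.2.2.2.2.1
  exact ⟨T, NodedQC.preservesOrientationOn_of_conformal T hconf
    (h₁.exists_fibres.1.denseRange.dense_image h₁.1 hdense), hconf, funext hT⟩
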